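/- **Setting.** Let $C(n,j)$ be the set of $j$-element subsets of $\{1,\dots,n\}$, with its lexicographic order. For $X\in C(n,j+1)$ the $j$-packet of $X$ is $P_X=\{A\in C(n,j): A\subset X\}$. An admissible $j$-order is a total order on $C(n,j)$ inducing the lexicographic or the antilexicographic order on every $j$-packet; $A(n,j)$ is the set of these, and $\mathrm{Inv}(\rho)$ is the set of $X\in C(n,j+1)$ such that $\rho$ is antilexicographic on $P_X$. $B(n,j)$ is the quotient of $A(n,j)$ by the equivalence relation generated by interchanging two neighbouring elements that lie in no common $j$-packet; $\mathrm{Inv}$ descends to $B(n,j)$. For $r,r'\in B(n,j)$ and $X\in C(n,j+1)\setminus \mathrm{Inv}(r)$ write $r\xrightarrow{X}r'$ (an upward packet flip) if some representative $\rho$ of $r$ contains $P_X$ as a contiguous block and reversing this block gives a representative of $r'$. For $J\subseteq C(n,j)$ let $J_p$ (resp. $J_s$) be the set of $X\in C(n,j+1)$ such that $P_X\cap J$ is a non-empty proper lexicographic prefix (resp. suffix) of $P_X$, let $J_F=\{X\in C(n,j+1): P_X\subseteq J\}$ and $J_\emptyset=\{X\in C(n,j+1): P_X\cap J=\emptyset\}$.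 $J$ is a realizable $j$-set if $J_s\cup J_p\cup J_F\cup J_\emptyset=C(n,j+1)$. Let $1<k\le n$ and let $J\subseteq C(n,k)$ be a realizable $k$-set. A path $\emptyset\to J$ in $B(n,k-1)$ is a sequence of upward packet flips $r_0\xrightarrow{X_1}r_1\xrightarrow{X_2}\cdots\xrightarrow{X_l}r_l$ with $\mathrm{Inv}(r_0)=\emptyset$ and $\mathrm{Inv}(r_l)=J$; it gives the total order $X_1<\dots<X_l$ on $J$. The inversion set of a path $\gamma$ is $\mathrm{Inv}(\gamma)=J_s\cup\{X\in J_F: \gamma \text{ is antilexicographic on } P_X\}$. Two paths are elementary equivalent if their orders differ by the interchange of two neighbouring elements that lie in no common $k$-packet; let $\mathcal P_J$ be the set of paths $\emptyset\to J$ modulo the equivalence relation $\sim$ generated by this. $\mathrm{Inv}$ descends to $\mathcal P_J$. For $r,r'\in \mathcal P_J$ put $r\le_{MS}r'$ if $r'$ is obtained from $r$ by a (possibly empty) sequence of upward packet flips at elements $X\in J_F$; such a flip takes a class having a representative $\gamma$ with $X\notin\mathrm{Inv}(\gamma)$ in which $P_X$ is a contiguous block to the class of a path whose order is that of $\gamma$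 with this block reversed. The single step inclusion order on a collection $\mathfrak U$ of finite sets is: $U\le_{SS} V$ if there is a chain $U=U_0\subset U_1\subset\dots\subset U_t=V$ ($t\ge 0$) of members of $\mathfrak U$ with $|U_i|=|U_{i-1}|+1$ for all $i$. **Theorem.** Let $1<k\le n$ and let $J$ be a realizable $k$-set. Then $\le_{MS}$ is a partial order on $\mathcal P_J$, $\le_{SS}$ is a partial order on the collection of all realizable $(k+1)$-sets $U$ with $J_s\subseteq U\subseteq J_s\cup J_F$, and the map $r\mapsto \mathrm{Inv}(r)$ is an isomorphism of posets from the former to the latter. -/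

import Mathlib

namespace HigherBruhat

/-- `C(n,k)`: the `k`-element subsets of the ground set, which is `Fin n` with its usual order. -/
def ksets (n k : ℕ) : Finset (Finset (Fin n)) :=
  Finset.powersetCard k Finset.univ

/-- The packet `P_X = C(X,k)` of a set `X` of size `k + 1`: the collection of its `k`-subsets. -/
def packet {n : ℕ} (k : ℕ) (X : Finset (Fin n)) : Finset (Finset (Fin n)) :=
  Finset.powersetCard k X

/-- Strict lexicographic order on subsets of the same size: the least element at which
`A` and `B` differ belongs to `A` (so the increasing word of `A` is smaller at the first place
where the two increasing words differ). -/
def LexLT {n : ℕ} (A B : Finset (Fin n)) : Prop :=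
  ∃ a : Fin n, a ∈ A ∧ a ∉ B ∧ ∀ b : Fin n, b < a → (b ∈ A ↔ b ∈ B)

instance decLexLT {n : ℕ} (A B : Finset (Fin n)) : Decidable (LexLT A B) := by
  unfold LexLT; infer_instance

/-- The total order given by the word `l`, restricted to `P_X`, is the lexicographic one.
Finite total orders are written as words: smallest element first, without repetitions. -/
def LexOn {n : ℕ} (k : ℕ) (X : Finset (Fin n)) (l : List (Finset (Fin n))) : Prop :=
  (l.filter (fun A => A ∈ packet k X)).Pairwise LexLT

/-- The total order given by the word `l`, restricted to `P_X`, is the antilexicographic one. -/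
def AntilexOn {n : ℕ} (k : ℕ) (X : Finset (Fin n)) (l : List (Finset (Fin n))) : Prop :=
  (l.filter (fun A => A ∈ packet k X)).Pairwise (fun A B => LexLT B A)

instance decAntilexOn {n : ℕ} (k : ℕ) (X : Finset (Fin n)) (l : List (Finset (Fin n))) :
    Decidable (AntilexOn k X l) := by
  unfold AntilexOn; infer_instance

/-- `A` and `B` lie in a common `k`-packet. -/
def SharePacket {n : ℕ} (k : ℕ) (A B : Finset (Fin n)) : Prop :=
  ∃ X ∈ ksets n (k + 1), A ∈ packet k X ∧ B ∈ packet k X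

/-- The words `l` and `l'` differ by the interchange of two neighbouring letters that are not in
a shared `k`-packet. -/
def SwapStep {n : ℕ} (k : ℕ) (l l' : List (Finset (Fin n))) : Prop :=
  ∃ (u v : List (Finset (Fin n))) (A B : Finset (Fin n)),
    l = u ++ A :: B :: v ∧ l' = u ++ B :: A :: v ∧ ¬ SharePacket k A B

/-- The packet `P_X` forms a contiguous block (a chain) of `l`, and `l'` arises from `l` by
reversing this block and leaving everything else in place. -/
def ReverseStep {n : ℕ} (k : ℕ) (X : Finset (Fin n)) (l l' : List (Finset (Fin n))) : Prop :=
  ∃ u w v : List (Finset (Fin n)),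
    l = u ++ w ++ v ∧ l' = u ++ w.reverse ++ v ∧ ∀ A, A ∈ w ↔ A ∈ packet k X

theorem SwapStep.antilexOn_iff {n k : ℕ} {l l' : List (Finset (Fin n))} (h : SwapStep k l l')
    {X : Finset (Fin n)} (hX : X ∈ ksets n (k + 1)) : AntilexOn k X l ↔ AntilexOn k X l' := by
  obtain ⟨u, v, A, B, rfl, rfl, hAB⟩ := h
  have hn : ¬ (A ∈ packet k X ∧ B ∈ packet k X) := fun h => hAB ⟨X, hX, h.1, h.2⟩
  unfold AntilexOn
  by_cases hA : A ∈ packet k X <;> by_cases hB : B ∈ packet k X <;>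
    simp_all [List.filter_append]

/-! ### The higher Bruhat order `B(n,k)` -/

/-- `A(n,k)`: the admissible total orders on `C(n,k)`, as words. -/
structure AdmOrder (n k : ℕ) where
  word : List (Finset (Fin n))
  nodup : word.Nodup
  mem_word : ∀ A, A ∈ word ↔ A ∈ ksets n k
  admissible : ∀ X ∈ ksets n (k + 1), LexOn k X word ∨ AntilexOn k X word

/-- The inversion set of an admissible order. -/
def AdmOrder.inv {n k : ℕ} (ρ : AdmOrder n k) : Finset (Finset (Fin n)) :=
  (ksets n (k + 1)).filter (fun X => AntilexOn k X ρ.word)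

/-- Elementary equivalence of admissible orders. -/
def AdmOrder.ElemEquiv {n k : ℕ} (ρ ρ' : AdmOrder n k) : Prop :=
  SwapStep k ρ.word ρ'.word

/-- `B(n,k)`: the quotient of `A(n,k)` by the equivalence relation generated by the elementary
equivalences. -/
def B (n k : ℕ) : Type :=
  Quot (AdmOrder.ElemEquiv (n := n) (k := k))

/-- The inversion set of an element of `B(n,k)`. -/
def B.inv {n k : ℕ} : B n k → Finset (Finset (Fin n)) :=
  Quot.lift AdmOrder.inv (fun _ _ h => Finset.filter_congr fun _ hX => h.antilexOn_iff hX)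

/-- `r' = p_X(r)` is the result of an (upward) packet flip at `X`: some representative of `r`
contains `P_X` as a chain, in lexicographic order, and reversing this chain gives a
representative of `r'`. -/
def B.FlipUp {n k : ℕ} (X : Finset (Fin n)) (r r' : B n k) : Prop :=
  X ∈ ksets n (k + 1) ∧ ∃ ρ ρ' : AdmOrder n k, Quot.mk _ ρ = r ∧ Quot.mk _ ρ' = r' ∧
    X ∉ ρ.inv ∧ ReverseStep k X ρ.word ρ'.word

/-! ### Prefixes, suffixes and realizable sets -/

/-- `S` is a (non-empty) lexicographic prefix of `T`. -/
def IsLexPrefix {n : ℕ} (S T : Finset (Finset (Fin n))) : Prop :=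
  S ⊆ T ∧ S.Nonempty ∧ ∀ A ∈ S, ∀ A' ∈ T, LexLT A' A → A' ∈ S

/-- `S` is a (non-empty) lexicographic suffix of `T`. -/
def IsLexSuffix {n : ℕ} (S T : Finset (Finset (Fin n))) : Prop :=
  S ⊆ T ∧ S.Nonempty ∧ ∀ A ∈ S, ∀ A' ∈ T, LexLT A A' → A' ∈ S

instance decLexPrefix {n : ℕ} (S T : Finset (Finset (Fin n))) : Decidable (IsLexPrefix S T) := by
  unfold IsLexPrefix; infer_instance

instance decLexSuffix {n : ℕ} (S T : Finset (Finset (Fin n))) : Decidable (IsLexSuffix S T) := by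
  unfold IsLexSuffix; infer_instance

/-- `J_p` for a set `J` of `k`-sets: its packet meets `J` in a proper prefix. -/
def setP (n k : ℕ) (J : Finset (Finset (Fin n))) : Finset (Finset (Fin n)) :=
  (ksets n (k + 1)).filter
    (fun X => IsLexPrefix (packet k X ∩ J) (packet k X) ∧ packet k X ∩ J ≠ packet k X)

/-- `J_s` for a set `J` of `k`-sets: its packet meets `J` in a proper suffix. -/
def setS (n k : ℕ) (J : Finset (Finset (Fin n))) : Finset (Finset (Fin n)) :=
  (ksets n (k + 1)).filter
    (fun X => IsLexSuffix (packet k X ∩ J) (packet k X) ∧ packet k X ∩ J ≠ packet k X)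

/-- `J_F` for a set `J` of `k`-sets: its packet is contained in `J`. -/
def setF (n k : ℕ) (J : Finset (Finset (Fin n))) : Finset (Finset (Fin n)) :=
  (ksets n (k + 1)).filter (fun X => packet k X ∩ J = packet k X)

/-- `J_∅` for a set `J` of `k`-sets: its packet does not meet `J`. -/
def setE (n k : ℕ) (J : Finset (Finset (Fin n))) : Finset (Finset (Fin n)) :=
  (ksets n (k + 1)).filter (fun X => packet k X ∩ J = ∅)

/-- `J` is a realizable `k`-set. -/
def Realizable (n k : ℕ) (J : Finset (Finset (Fin n))) : Prop :=
  J ⊆ ksets n k ∧ setS n k J ∪ setP n k J ∪ setF n k J ∪ setE n k J = ksets n (k + 1)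

/-! ### Paths in `B(n,m)` -/

/-- The steps `(X₁, r₁), …, (Xₗ, rₗ)` form a chain of upward packet flips
`r → r₁ → ⋯ → rₗ = s`, the `i`-th one at `Xᵢ`. -/
def IsFlipChain {n m : ℕ} (r : B n m) : List (Finset (Fin n) × B n m) → B n m → Prop
  | [], s => r = s
  | (X, t) :: l, s => B.FlipUp X r t ∧ IsFlipChain t l s

/-- A path from `K` to `J` in `B(n,m)`: a chain of upward packet flips which starts at an
element with inversion set `K` and ends at one with inversion set `J`. -/
structure FlipPath (n m : ℕ) (K J : Finset (Finset (Fin n))) where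
  src : B n m
  steps : List (Finset (Fin n) × B n m)
  tgt : B n m
  chain : IsFlipChain src steps tgt
  inv_src : src.inv = K
  inv_tgt : tgt.inv = J

/-- The total order on `J` given by a path from `∅` to `J`: the flipped sets, in the order in
which they are flipped. -/
def FlipPath.word {n m : ℕ} {K J : Finset (Finset (Fin n))} (γ : FlipPath n m K J) :
    List (Finset (Fin n)) :=
  γ.steps.map Prod.fst

/-- The inversion set of a path from `∅` to the `(m+1)`-set `J` in `B(n,m)`. -/
def FlipPath.inv {n m : ℕ} {J : Finset (Finset (Fin n))} (γ : FlipPath n m ∅ J) :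
    Finset (Finset (Fin n)) :=
  (setF n (m + 1) J).filter (fun X => AntilexOn (m + 1) X γ.word) ∪ setS n (m + 1) J

/-- Elementary equivalence of paths. -/
def FlipPath.ElemEquiv {n m : ℕ} {J : Finset (Finset (Fin n))} (γ γ' : FlipPath n m ∅ J) : Prop :=
  SwapStep (m + 1) γ.word γ'.word

/-- Equivalence classes of paths from `∅` to `J` in `B(n,m)`, for the equivalence relation
generated by the elementary equivalences. -/
def PathClass (n m : ℕ) (J : Finset (Finset (Fin n))) : Type :=
  Quot (FlipPath.ElemEquiv (n := n) (m := m) (J := J))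

/-- The inversion set of a class of paths. -/
def PathClass.inv {n m : ℕ} {J : Finset (Finset (Fin n))} :
    PathClass n m J → Finset (Finset (Fin n)) :=
  Quot.lift FlipPath.inv (fun _ _ h => by
    unfold FlipPath.inv
    congr 1
    exact Finset.filter_congr fun _ hX => h.antilexOn_iff (Finset.mem_filter.1 hX).1)

/-- `r' = p_X(r)` is the result of an upward packet flip of `r` at some `X ∈ J_F`. -/
def PathClass.FlipUp {n m : ℕ} {J : Finset (Finset (Fin n))} (r r' : PathClass n m J) : Prop :=
  ∃ X ∈ setF n (m + 1) J, ∃ γ γ' : FlipPath n m ∅ J, Quot.mk _ γ = r ∧ Quot.mk _ γ' = r' ∧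
    X ∉ γ.inv ∧ ReverseStep (m + 1) X γ.word γ'.word

/-- The Manin-Schechtman order on classes of paths: a (possibly empty) sequence of upward packet
flips leads from `r` to `r'`. -/
def PathClass.msLE {n m : ℕ} {J : Finset (Finset (Fin n))} (r r' : PathClass n m J) : Prop :=
  Relation.ReflTransGen PathClass.FlipUp r r'

/-! ### Single step inclusion -/

/-- The single step inclusion order on a collection of finite sets. -/
def ssoLE {α : Type*} (𝔘 : Set (Finset α)) (U V : 𝔘) : Prop :=
  Relation.ReflTransGen
    (fun U₁ U₂ : 𝔘 => U₁.1 ⊂ U₂.1 ∧ U₂.1.card = U₁.1.card + 1) U V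

/-- The realizable `(k+1)`-sets between `J_s` and `J_s ∪ J_F`. -/
def realizableBetween (n k : ℕ) (J : Finset (Finset (Fin n))) : Set (Finset (Finset (Fin n))) :=
  {U | Realizable n (k + 1) U ∧ setS n k J ⊆ U ∧ U ⊆ setS n k J ∪ setF n k J}

end HigherBruhat

namespace HigherBruhat

variable {n k m : ℕ}

/-! A set `U` of `(k+1)`-sets prescribes a relation on `k`-sets: two distinct members of a packet
`P_X` are ordered antilexicographically if `X ∈ U` and lexicographically otherwise (`Arrow`).
Everything is reduced to linear extensions of this relation on a set `J`, written as words (`Good`).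

Three facts carry the proof. If `U` is realizable, the relation is acyclic
(`Realizable.exists_rank`), so linear extensions exist. Conversely, for realizable `J`, a linear
extension on `J` with `J_s ⊆ U ⊆ J_s ∪ J_F` forces `U` to be realizable (`Good.realizable`).
Finally, any two linear extensions of the same relation differ by interchanges of neighbours in no
common packet (`Good.swapSteps`).

With `J` the set of all `k`-sets, this identifies `B(n,k)`, for `k > 0`, with the realizable
`(k+1)`-sets, upward flips being additions of one element. A path from `∅` to `J` is therefore an
enumeration of `J` all of whose prefixes are realizable. These enumerations are exactly the linear
extensions on `J` for the sets `U` between the two bounds (`good_of_realizable_take`,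
`Good.realizable_take`), so the same three facts give the bijection on path classes.

For the orders, it remains to realize a one-element inclusion by a flip: if `U` and `U ∪ {X}` are
both realizable and `X ∈ J_F`, some linear extension for `U` has `P_X` as a contiguous block
(`Realizable.exists_good_block`). -/

theorem mem_ksets {A : Finset (Fin n)} : A ∈ ksets n k ↔ A.card = k := by
  simp [ksets, Finset.mem_powersetCard]

/-! ### Packets in terms of the deleted element -/

/-- Deletion reverses order. Hence a lexicographic suffix of a packet corresponds to an initial
segment of deleted elements, and a prefix to a final segment. -/
theorem lexLT_erase {X : Finset (Fin n)} {a b : Fin n} (ha : a ∈ X) (hb : b ∈ X) :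
    LexLT (X.erase a) (X.erase b) ↔ b < a := by
  constructor
  · rintro ⟨c, hc, hc', h⟩
    have hcb : c = b := by
      by_contra hne
      exact hc' (Finset.mem_erase.2 ⟨hne, Finset.mem_of_mem_erase hc⟩)
    subst hcb
    rcases lt_trichotomy c a with h1 | h1 | h1
    · exact h1
    · exact absurd h1 (Finset.ne_of_mem_erase hc)
    · have := (h a h1).2 (Finset.mem_erase.2 ⟨h1.ne, ha⟩)
      simp at this
  · intro h
    refine ⟨b, by simp [hb, h.ne], by simp, fun c hc => ?_⟩
    simp [hc.ne, (hc.trans h).ne]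

theorem erase_mem_ksets {X : Finset (Fin n)} (hX : X ∈ ksets n (k + 1)) {a : Fin n} (ha : a ∈ X) :
    X.erase a ∈ ksets n k := by
  rw [mem_ksets] at *
  rw [Finset.card_erase_of_mem ha]; omega

theorem mem_packet {X : Finset (Fin n)} (hX : X ∈ ksets n (k + 1)) {A : Finset (Fin n)} :
    A ∈ packet k X ↔ ∃ a ∈ X, A = X.erase a := by
  rw [packet, Finset.mem_powersetCard]
  rw [mem_ksets] at hX
  constructor
  · rintro ⟨hs, hc⟩
    have h1 : (X \ A).card = 1 := by rw [Finset.card_sdiff_of_subset hs]; omega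
    obtain ⟨a, ha⟩ := Finset.card_eq_one.1 h1
    have haX : a ∈ X \ A := by rw [ha]; simp
    refine ⟨a, (Finset.mem_sdiff.1 haX).1, ?_⟩
    rw [Finset.erase_eq, ← ha, Finset.sdiff_sdiff_eq_self hs]
  · rintro ⟨a, ha, rfl⟩
    exact ⟨Finset.erase_subset _ _, by rw [Finset.card_erase_of_mem ha]; omega⟩

theorem erase_injOn {X : Finset (Fin n)} {a b : Fin n} (ha : a ∈ X)
    (h : X.erase a = X.erase b) : a = b := by
  by_contra hne
  have : a ∈ X.erase b := Finset.mem_erase.2 ⟨hne, ha⟩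
  rw [← h] at this
  simp at this

/-! ### Realizability as a condition on triples of deletions -/

theorem mem_setF {J : Finset (Finset (Fin n))} {X : Finset (Fin n)} :
    X ∈ setF n k J ↔ X ∈ ksets n (k + 1) ∧ ∀ a ∈ X, X.erase a ∈ J := by
  rw [setF, Finset.mem_filter]
  refine and_congr_right fun hX => ?_
  rw [Finset.inter_eq_left]
  constructor
  · exact fun h a ha => h ((mem_packet hX).2 ⟨a, ha, rfl⟩)
  · intro h A hA
    obtain ⟨a, ha, rfl⟩ := (mem_packet hX).1 hA
    exact h a ha

theorem mem_setE {J : Finset (Finset (Fin n))} {X : Finset (Fin n)} :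
    X ∈ setE n k J ↔ X ∈ ksets n (k + 1) ∧ ∀ a ∈ X, X.erase a ∉ J := by
  rw [setE, Finset.mem_filter]
  refine and_congr_right fun hX => ?_
  rw [Finset.eq_empty_iff_forall_notMem]
  constructor
  · exact fun h a ha hJ => h _ (Finset.mem_inter.2 ⟨(mem_packet hX).2 ⟨a, ha, rfl⟩, hJ⟩)
  · intro h A hA
    obtain ⟨a, ha, rfl⟩ := (mem_packet hX).1 (Finset.mem_inter.1 hA).1
    exact h a ha (Finset.mem_inter.1 hA).2

theorem inter_ne_packet_iff {J : Finset (Finset (Fin n))} {X : Finset (Fin n)}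
    (hX : X ∈ ksets n (k + 1)) :
    packet k X ∩ J ≠ packet k X ↔ ∃ a ∈ X, X.erase a ∉ J := by
  have := mem_setF (k := k) (J := J) (X := X)
  rw [setF, Finset.mem_filter] at this
  simp only [hX, true_and] at this
  rw [Ne, this]
  push Not
  rfl

theorem inter_nonempty_iff {J : Finset (Finset (Fin n))} {X : Finset (Fin n)}
    (hX : X ∈ ksets n (k + 1)) :
    (packet k X ∩ J).Nonempty ↔ ∃ a ∈ X, X.erase a ∈ J := by
  constructor
  · rintro ⟨A, hA⟩
    obtain ⟨a, ha, rfl⟩ := (mem_packet hX).1 (Finset.mem_inter.1 hA).1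
    exact ⟨a, ha, (Finset.mem_inter.1 hA).2⟩
  · rintro ⟨a, ha, h⟩
    exact ⟨_, Finset.mem_inter.2 ⟨(mem_packet hX).2 ⟨a, ha, rfl⟩, h⟩⟩

theorem mem_setS {J : Finset (Finset (Fin n))} {X : Finset (Fin n)} :
    X ∈ setS n k J ↔ X ∈ ksets n (k + 1) ∧ (∃ a ∈ X, X.erase a ∈ J) ∧ (∃ a ∈ X, X.erase a ∉ J) ∧
      ∀ a ∈ X, ∀ b ∈ X, a < b → X.erase b ∈ J → X.erase a ∈ J := by
  rw [setS, Finset.mem_filter]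
  refine and_congr_right fun hX => ?_
  rw [inter_ne_packet_iff hX, IsLexSuffix, inter_nonempty_iff hX]
  constructor
  · rintro ⟨⟨-, h1, h2⟩, h3⟩
    refine ⟨h1, h3, fun a ha b hb hab hJ => ?_⟩
    exact (Finset.mem_inter.1 (h2 (X.erase b) (Finset.mem_inter.2
      ⟨(mem_packet hX).2 ⟨b, hb, rfl⟩, hJ⟩) _ ((mem_packet hX).2 ⟨a, ha, rfl⟩)
      ((lexLT_erase hb ha).2 hab))).2
  · rintro ⟨h1, h3, h2⟩
    refine ⟨⟨Finset.inter_subset_left, h1, fun A hA A' hA' hlt => ?_⟩, h3⟩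
    obtain ⟨b, hb, rfl⟩ := (mem_packet hX).1 (Finset.mem_inter.1 hA).1
    obtain ⟨a, ha, rfl⟩ := (mem_packet hX).1 hA'
    exact Finset.mem_inter.2 ⟨hA', h2 a ha b hb ((lexLT_erase hb ha).1 hlt)
      (Finset.mem_inter.1 hA).2⟩

theorem mem_setP {J : Finset (Finset (Fin n))} {X : Finset (Fin n)} :
    X ∈ setP n k J ↔ X ∈ ksets n (k + 1) ∧ (∃ a ∈ X, X.erase a ∈ J) ∧ (∃ a ∈ X, X.erase a ∉ J) ∧
      ∀ a ∈ X, ∀ b ∈ X, a < b → X.erase a ∈ J → X.erase b ∈ J := by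
  rw [setP, Finset.mem_filter]
  refine and_congr_right fun hX => ?_
  rw [inter_ne_packet_iff hX, IsLexPrefix, inter_nonempty_iff hX]
  constructor
  · rintro ⟨⟨-, h1, h2⟩, h3⟩
    refine ⟨h1, h3, fun a ha b hb hab hJ => ?_⟩
    exact (Finset.mem_inter.1 (h2 (X.erase a) (Finset.mem_inter.2
      ⟨(mem_packet hX).2 ⟨a, ha, rfl⟩, hJ⟩) _ ((mem_packet hX).2 ⟨b, hb, rfl⟩)
      ((lexLT_erase hb ha).2 hab))).2
  · rintro ⟨h1, h3, h2⟩
    refine ⟨⟨Finset.inter_subset_left, h1, fun A hA A' hA' hlt => ?_⟩, h3⟩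
    obtain ⟨a, ha, rfl⟩ := (mem_packet hX).1 (Finset.mem_inter.1 hA).1
    obtain ⟨b, hb, rfl⟩ := (mem_packet hX).1 hA'
    exact Finset.mem_inter.2 ⟨hA', h2 a ha b hb ((lexLT_erase hb ha).1 hlt)
      (Finset.mem_inter.1 hA).2⟩

/-- A family of `k`-sets is realizable iff membership in it changes at most once along
every packet. -/
theorem realizable_iff {J : Finset (Finset (Fin n))} :
    Realizable n k J ↔ J ⊆ ksets n k ∧ ∀ X ∈ ksets n (k + 1), ∀ a ∈ X, ∀ b ∈ X, ∀ c ∈ X,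
      a < b → b < c → (X.erase a ∈ J → X.erase c ∈ J → X.erase b ∈ J) ∧
        (X.erase b ∈ J → X.erase a ∈ J ∨ X.erase c ∈ J) := by
  refine and_congr_right fun _ => ?_
  constructor
  · intro h X hX a ha b hb c hc hab hbc
    rw [← h] at hX
    simp only [Finset.mem_union, mem_setS, mem_setP, mem_setF, mem_setE] at hX
    rcases hX with ((⟨-, -, -, h⟩ | ⟨-, -, -, h⟩) | ⟨-, h⟩) | ⟨-, h⟩
    · exact ⟨fun _ h2 => h b hb c hc hbc h2, fun h1 => .inl (h a ha b hb hab h1)⟩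
    · exact ⟨fun h1 _ => h a ha b hb hab h1, fun h1 => .inr (h b hb c hc hbc h1)⟩
    · exact ⟨fun _ _ => h b hb, fun _ => .inl (h a ha)⟩
    · exact ⟨fun h1 => absurd h1 (h a ha), fun h1 => absurd h1 (h b hb)⟩
  · intro h
    ext X
    constructor
    · simp only [Finset.mem_union, mem_setS, mem_setP, mem_setF, mem_setE]
      tauto
    · intro hX
      simp only [Finset.mem_union, mem_setS, mem_setP, mem_setF, mem_setE, hX, true_and]
      by_cases hF : ∀ a ∈ X, X.erase a ∈ J
      · exact .inl (.inr hF)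
      by_cases hE : ∀ a ∈ X, X.erase a ∉ J
      · exact .inr hE
      push Not at hF hE
      left; left
      obtain ⟨b, hb, hbJ⟩ := hF
      obtain ⟨a, ha, haJ⟩ := hE
      have hne : a ≠ b := fun h => hbJ (h ▸ haJ)
      rcases lt_or_gt_of_ne hne with hab | hab
      · refine .inl ⟨⟨a, ha, haJ⟩, ⟨b, hb, hbJ⟩, fun c hc d hd hcd hdJ => ?_⟩
        by_contra hcJ
        have hne' : a ≠ c := fun h => hcJ (h ▸ haJ)
        rcases lt_or_gt_of_ne hne' with hac | hac
        · exact hcJ ((h X hX a ha c hc d hd hac hcd).1 haJ hdJ)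
        · exact ((h X hX c hc a ha b hb hac hab).2 haJ).elim hcJ hbJ
      · refine .inr ⟨⟨a, ha, haJ⟩, ⟨b, hb, hbJ⟩, fun c hc d hd hcd hcJ => ?_⟩
        by_contra hdJ
        have hne' : a ≠ d := fun h => hdJ (h ▸ haJ)
        rcases lt_or_gt_of_ne hne' with hac | hac
        · exact ((h X hX b hb a ha d hd hab hac).2 haJ).elim hbJ hdJ
        · exact hdJ ((h X hX c hc d hd a ha hcd hac).1 hcJ haJ)

theorem Realizable.mem_cases {J : Finset (Finset (Fin n))} (hJ : Realizable n k J)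
    {X : Finset (Fin n)} (hX : X ∈ ksets n (k + 1)) :
    X ∈ setS n k J ∨ X ∈ setP n k J ∨ X ∈ setF n k J ∨ X ∈ setE n k J := by
  rw [← hJ.2] at hX
  simpa [or_assoc] using hX

theorem realizable_ksets : Realizable n k (ksets n k) :=
  realizable_iff.2 ⟨subset_rfl, fun _ hX _ ha _ hb _ _ _ _ =>
    ⟨fun _ _ => erase_mem_ksets hX hb, fun _ => .inl (erase_mem_ksets hX ha)⟩⟩

theorem setS_ksets : setS n k (ksets n k) = ∅ := by
  ext X
  simp only [mem_setS, Finset.notMem_empty, iff_false]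
  rintro ⟨hX, -, ⟨a, ha, h⟩, -⟩
  exact h (erase_mem_ksets hX ha)

theorem setF_ksets : setF n k (ksets n k) = ksets n (k + 1) := by
  ext X
  rw [mem_setF]
  exact ⟨fun h => h.1, fun h => ⟨h, fun a ha => erase_mem_ksets h ha⟩⟩

/-! ### The prescribed relation and its acyclicity -/

/-- The order relation which `U` prescribes for two distinct members of a common `k`-packet:
lexicographic on the packets outside `U`, antilexicographic on those in `U`. -/
def Arrow (k : ℕ) (U : Finset (Finset (Fin n))) (A B : Finset (Fin n)) : Prop :=
  ∃ X ∈ ksets n (k + 1), ∃ a ∈ X, ∃ b ∈ X, A = X.erase a ∧ B = X.erase b ∧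
    ((b < a ∧ X ∉ U) ∨ (a < b ∧ X ∈ U))

theorem union_erase {X : Finset (Fin n)} {a b : Fin n} (hab : a ≠ b) :
    X.erase a ∪ X.erase b = X := by
  ext c
  simp only [Finset.mem_union, Finset.mem_erase]
  constructor
  · tauto
  · intro h
    by_cases hc : c = a
    · exact .inr ⟨hc ▸ hab, h⟩
    · exact .inl ⟨hc, h⟩

/-- Two distinct members of a packet have union `X`, so the packet deciding their order is unique
and the existential in `Arrow` collapses. -/
theorem arrow_erase {U : Finset (Finset (Fin n))} {X : Finset (Fin n)}
    (hX : X ∈ ksets n (k + 1)) {a b : Fin n} (ha : a ∈ X) (hb : b ∈ X) (hab : a ≠ b) :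
    Arrow k U (X.erase a) (X.erase b) ↔ (b < a ∧ X ∉ U) ∨ (a < b ∧ X ∈ U) := by
  constructor
  · rintro ⟨Y, hY, c, hc, d, hd, h1, h2, h⟩
    have hcd : c ≠ d := by rcases h with h | h; exacts [h.1.ne', h.1.ne]
    have hXY : X = Y := by
      rw [← union_erase (X := X) hab, h1, h2, union_erase hcd]
    subst hXY
    rw [erase_injOn ha h1, erase_injOn hb h2]
    exact h
  · intro h
    exact ⟨X, hX, a, ha, b, hb, rfl, rfl, h⟩

theorem sharePacket_erase {X : Finset (Fin n)}
    (hX : X ∈ ksets n (k + 1)) {a b : Fin n} (ha : a ∈ X) (hb : b ∈ X) :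
    SharePacket k (X.erase a) (X.erase b) :=
  ⟨X, hX, (mem_packet hX).2 ⟨a, ha, rfl⟩, (mem_packet hX).2 ⟨b, hb, rfl⟩⟩

theorem Arrow.sharePacket {U : Finset (Finset (Fin n))} {A B : Finset (Fin n)}
    (h : Arrow k U A B) : SharePacket k A B := by
  obtain ⟨X, hX, a, ha, b, hb, rfl, rfl, -⟩ := h
  exact sharePacket_erase hX ha hb

theorem SharePacket.arrow_or {A B : Finset (Fin n)} (h : SharePacket k A B) (hne : A ≠ B)
    (U : Finset (Finset (Fin n))) : Arrow k U A B ∨ Arrow k U B A := by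
  obtain ⟨X, hX, h1, h2⟩ := h
  obtain ⟨a, ha, rfl⟩ := (mem_packet hX).1 h1
  obtain ⟨b, hb, rfl⟩ := (mem_packet hX).1 h2
  have hab : a ≠ b := fun h => hne (h ▸ rfl)
  rw [arrow_erase hX ha hb hab, arrow_erase hX hb ha hab.symm]
  rcases lt_or_gt_of_ne hab with h | h <;> by_cases hU : X ∈ U <;> simp [h, hU]

/-- The relation prescribed by a realizable set is acyclic. -/
theorem Realizable.exists_rank_aux {U : Finset (Finset (Fin n))} (hU : Realizable n (k + 1) U)
    (S : Finset (Fin n)) : ∀ T : Finset (Fin n), ∃ f : Finset (Fin n) → ℕ, ∀ A B,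
      A \ S = T → B \ S = T → Arrow k U A B → f A < f B := by
  -- Only sets with the same part outside `S` are compared, so they differ only inside `S`.
  -- Splitting off the maximum `m` of `S` gives the sets without `m` (outer part `T`) and those with
  -- `m` (outer part `insert m T`).
  induction S using Finset.induction_on_max with
  | empty =>
    refine fun T => ⟨fun _ => 0, fun A B hA hB h => ?_⟩
    obtain ⟨X, hX, a, ha, b, hb, rfl, rfl, h⟩ := h
    rw [Finset.sdiff_empty] at hA hB
    have := erase_injOn ha (hA.trans hB.symm)
    subst this
    simp at h
  | insert m S hm ih =>
    intro T
    have hmS : m ∉ S := fun h => lt_irrefl _ (hm m h)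
    obtain ⟨f, hf⟩ := ih T
    obtain ⟨g, hg⟩ := ih (insert m T)
    obtain ⟨M, hM⟩ : ∃ M, ∀ A, f A < M ∧ g A < M := by
      refine ⟨Finset.univ.sup f + Finset.univ.sup g + 1, fun A => ?_⟩
      have h1 := Finset.le_sup (f := f) (Finset.mem_univ A)
      have h2 := Finset.le_sup (f := g) (Finset.mem_univ A)
      omega
    -- Three disjoint ranges of values: first the sets without `m` whose extension by `m` is outside
    -- `U`, then the sets containing `m`, then the sets without `m` whose extension is in `U`. This
    -- is forced: since `m` is maximal, `X.erase m` precedes the relevant members of `P_X` exactly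
    -- when `X ∉ U`.
    refine ⟨fun A => if m ∈ A then M + g A else if insert m A ∈ U then 2 * M + f A else f A,
      fun A B hA hB h => ?_⟩
    have hin : ∀ C : Finset (Fin n), C \ insert m S = T → m ∈ C → C \ S = insert m T := by
      rintro C rfl hC
      ext x
      by_cases hx : x = m
      · subst hx; simp [hC, hmS]
      · simp [hx]
    have hout : ∀ C : Finset (Fin n), C \ insert m S = T → m ∉ C → C \ S = T := by
      rintro C rfl hC
      ext x
      by_cases hx : x = m
      · subst hx; simp [hC]
      · simp [hx]
    have harr := h
    obtain ⟨X, hX, a, ha, b, hb, rfl, rfl, h⟩ := h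
    have hab : a ≠ b := by rcases h with h | h; exacts [h.1.ne', h.1.ne]
    have haS : a ∈ insert m S := by
      by_contra hc
      have : a ∈ X.erase b \ insert m S :=
        Finset.mem_sdiff.2 ⟨Finset.mem_erase.2 ⟨hab, ha⟩, hc⟩
      rw [hB, ← hA] at this
      simp at this
    have hbS : b ∈ insert m S := by
      by_contra hc
      have : b ∈ X.erase a \ insert m S :=
        Finset.mem_sdiff.2 ⟨Finset.mem_erase.2 ⟨hab.symm, hb⟩, hc⟩
      rw [hA, ← hB] at this
      simp at this
    have hMa := hM (X.erase a)
    have hMb := hM (X.erase b)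
    by_cases hma : m ∈ X.erase a <;> by_cases hmb : m ∈ X.erase b
    · simp only [hma, hmb, if_true]
      have := hg _ _ (hin _ hA hma) (hin _ hB hmb) harr
      omega
    · have hbm : b = m := by
        by_contra hc
        exact hmb (Finset.mem_erase.2 ⟨Ne.symm hc, Finset.mem_of_mem_erase hma⟩)
      subst hbm
      have hab' : a < b := hm a ((Finset.mem_insert.1 haS).resolve_left hab)
      have hXU : X ∈ U := by rcases h with h | h; exacts [absurd h.1 (not_lt.2 hab'.le), h.2]
      simp only [hma, hmb, if_true, if_false, Finset.insert_erase hb, hXU]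
      omega
    · have ham : a = m := by
        by_contra hc
        exact hma (Finset.mem_erase.2 ⟨Ne.symm hc, Finset.mem_of_mem_erase hmb⟩)
      subst ham
      have hab' : b < a := hm b ((Finset.mem_insert.1 hbS).resolve_left hab.symm)
      have hXU : X ∉ U := by rcases h with h | h; exacts [h.2, absurd h.1 (not_lt.2 hab'.le)]
      simp only [hma, hmb, if_true, if_false, Finset.insert_erase ha, hXU]
      omega
    · have hlt := hf _ _ (hout _ hA hma) (hout _ hB hmb) harr
      have hmX : m ∉ X := by
        intro hmX
        rw [Finset.mem_erase, not_and'] at hma hmb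
        exact hab ((not_not.1 (hma hmX)).symm.trans (not_not.1 (hmb hmX)))
      have ham : a < m := hm a ((Finset.mem_insert.1 haS).resolve_left fun h => hmX (h ▸ ha))
      have hbm : b < m := hm b ((Finset.mem_insert.1 hbS).resolve_left fun h => hmX (h ▸ hb))
      have hY : insert m X ∈ ksets n (k + 1 + 1) := by
        rw [mem_ksets] at *
        rw [Finset.card_insert_of_notMem hmX, hX]
      have e1 : (insert m X).erase m = X := Finset.erase_insert hmX
      have e2 : insert m (X.erase a) = (insert m X).erase a :=
        (Finset.erase_insert_of_ne ham.ne').symm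
      have e3 : insert m (X.erase b) = (insert m X).erase b :=
        (Finset.erase_insert_of_ne hbm.ne').symm
      -- No arrow leads from the last range back to the first: this is realizability of `U` on the
      -- packet of `insert m X`, where `m` is larger than `a` and `b` and its deletion is `X`.
      have key : insert m (X.erase a) ∈ U → insert m (X.erase b) ∈ U := by
        rw [e2, e3]
        intro h1
        have hmY : m ∈ insert m X := Finset.mem_insert_self _ _
        have haY : a ∈ insert m X := Finset.mem_insert_of_mem ha
        have hbY : b ∈ insert m X := Finset.mem_insert_of_mem hb
        rcases h with h | h
        · have := ((realizable_iff.1 hU).2 _ hY b hbY a haY m hmY h.1 ham).2 h1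
          rw [e1] at this
          exact this.resolve_right h.2
        · have := ((realizable_iff.1 hU).2 _ hY a haY b hbY m hmY h.1 hbm).1 h1
          rw [e1] at this
          exact this h.2
      simp only [hma, hmb, if_false]
      split_ifs with h1 h2
      · omega
      · exact absurd (key h1) h2
      · omega
      · exact hlt

theorem Realizable.exists_rank {U : Finset (Finset (Fin n))} (hU : Realizable n (k + 1) U) :
    ∃ f : Finset (Fin n) → ℕ, ∀ A B, Arrow k U A B → f A < f B := by
  obtain ⟨f, hf⟩ := hU.exists_rank_aux Finset.univ ∅
  exact ⟨f, fun A B => hf A B (by simp) (by simp)⟩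

/-! ### Linear extensions as words -/

theorem pairwise_iff_idxOf {α : Type*} [DecidableEq α] {R : α → α → Prop} {l : List α}
    (hl : l.Nodup) :
    l.Pairwise R ↔ ∀ a ∈ l, ∀ b ∈ l, l.idxOf a < l.idxOf b → R a b := by
  rw [List.pairwise_iff_getElem]
  constructor
  · intro h a ha b hb hab
    have := h _ _ (List.idxOf_lt_length_of_mem ha) (List.idxOf_lt_length_of_mem hb) hab
    simpa using this
  · intro h i j hi hj hij
    refine h _ (List.getElem_mem hi) _ (List.getElem_mem hj) ?_
    rwa [hl.idxOf_getElem, hl.idxOf_getElem]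

theorem mem_take_iff_idxOf {α : Type*} [DecidableEq α] {l : List α} {a : α} (i : ℕ)
    (ha : a ∈ l) : a ∈ l.take i ↔ l.idxOf a < i := by
  induction l generalizing i with
  | nil => simp at ha
  | cons b l ih =>
    cases i with
    | zero => simp
    | succ i =>
      by_cases hab : a = b
      · subst hab; simp
      · have ha' : a ∈ l := (List.mem_cons.1 ha).resolve_left hab
        simp [hab, List.idxOf_cons_ne _ (Ne.symm hab), ih i ha']

theorem idxOf_ne {α : Type*} [DecidableEq α] {l : List α} {a b : α} (ha : a ∈ l) (h : a ≠ b) :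
    l.idxOf a ≠ l.idxOf b := fun h' => h ((List.idxOf_inj ha).1 h')

/-- The word `l` enumerates `J` compatibly with the relation prescribed by `U`. -/
structure Good (k : ℕ) (J U : Finset (Finset (Fin n))) (l : List (Finset (Fin n))) : Prop where
  nodup : l.Nodup
  mem : ∀ A, A ∈ l ↔ A ∈ J
  pairwise : l.Pairwise fun A B => ¬ Arrow k U B A

theorem Good.not_arrow {J U : Finset (Finset (Fin n))} {l : List (Finset (Fin n))}
    (h : Good k J U l) {A B : Finset (Fin n)} (hA : A ∈ J) (hB : B ∈ J)
    (hAB : l.idxOf A < l.idxOf B) : ¬ Arrow k U B A :=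
  (pairwise_iff_idxOf h.nodup).1 h.pairwise A ((h.mem A).2 hA) B ((h.mem B).2 hB) hAB

theorem Good.lt_of_arrow {J U : Finset (Finset (Fin n))} {l : List (Finset (Fin n))}
    (h : Good k J U l) {A B : Finset (Fin n)} (hA : A ∈ J) (hB : B ∈ J) (hne : A ≠ B)
    (hAB : Arrow k U A B) : l.idxOf A < l.idxOf B := by
  rcases lt_or_gt_of_ne (idxOf_ne ((h.mem A).2 hA) hne) with h1 | h1
  · exact h1
  · exact absurd hAB (h.not_arrow hB hA h1)

/-- Inside a packet, a compatible word is antilexicographic if the packet belongs to `U`. -/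
theorem Good.lt_of_mem {J U : Finset (Finset (Fin n))} {l : List (Finset (Fin n))}
    (h : Good k J U l) {X : Finset (Fin n)} (hX : X ∈ ksets n (k + 1)) (hXU : X ∈ U) {a b : Fin n}
    (ha : a ∈ X) (hb : b ∈ X) (hab : a < b) (hA : X.erase a ∈ J) (hB : X.erase b ∈ J) :
    l.idxOf (X.erase a) < l.idxOf (X.erase b) :=
  h.lt_of_arrow hA hB (fun h => hab.ne (erase_injOn ha h))
    ((arrow_erase hX ha hb hab.ne).2 (.inr ⟨hab, hXU⟩))

/-- Inside a packet, a compatible word is lexicographic if the packet is not in `U`. -/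
theorem Good.lt_of_notMem {J U : Finset (Finset (Fin n))} {l : List (Finset (Fin n))}
    (h : Good k J U l) {X : Finset (Fin n)} (hX : X ∈ ksets n (k + 1)) (hXU : X ∉ U) {a b : Fin n}
    (ha : a ∈ X) (hb : b ∈ X) (hab : a < b) (hA : X.erase a ∈ J) (hB : X.erase b ∈ J) :
    l.idxOf (X.erase b) < l.idxOf (X.erase a) :=
  h.lt_of_arrow hB hA (fun h => hab.ne' (erase_injOn hb h))
    ((arrow_erase hX hb ha hab.ne').2 (.inl ⟨hab, hXU⟩))

theorem antilexOn_iff_idxOf {l : List (Finset (Fin n))} (hl : l.Nodup) {X : Finset (Fin n)}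
    (hX : X ∈ ksets n (k + 1)) :
    AntilexOn k X l ↔ ∀ a ∈ X, ∀ b ∈ X, X.erase a ∈ l → X.erase b ∈ l →
      l.idxOf (X.erase a) < l.idxOf (X.erase b) → a < b := by
  rw [AntilexOn, List.pairwise_filter, pairwise_iff_idxOf hl]
  simp only [decide_eq_true_eq]
  constructor
  · intro h a ha b hb hal hbl hlt
    exact (lexLT_erase hb ha).1 (h _ hal _ hbl hlt ((mem_packet hX).2 ⟨a, ha, rfl⟩)
      ((mem_packet hX).2 ⟨b, hb, rfl⟩))
  · intro h A hA B hB hlt hAX hBX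
    obtain ⟨a, ha, rfl⟩ := (mem_packet hX).1 hAX
    obtain ⟨b, hb, rfl⟩ := (mem_packet hX).1 hBX
    exact (lexLT_erase hb ha).2 (h a ha b hb hA hB hlt)

theorem lexOn_iff_idxOf {l : List (Finset (Fin n))} (hl : l.Nodup) {X : Finset (Fin n)}
    (hX : X ∈ ksets n (k + 1)) :
    LexOn k X l ↔ ∀ a ∈ X, ∀ b ∈ X, X.erase a ∈ l → X.erase b ∈ l →
      l.idxOf (X.erase a) < l.idxOf (X.erase b) → b < a := by
  rw [LexOn, List.pairwise_filter, pairwise_iff_idxOf hl]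
  simp only [decide_eq_true_eq]
  constructor
  · intro h a ha b hb hal hbl hlt
    exact (lexLT_erase ha hb).1 (h _ hal _ hbl hlt ((mem_packet hX).2 ⟨a, ha, rfl⟩)
      ((mem_packet hX).2 ⟨b, hb, rfl⟩))
  · intro h A hA B hB hlt hAX hBX
    obtain ⟨a, ha, rfl⟩ := (mem_packet hX).1 hAX
    obtain ⟨b, hb, rfl⟩ := (mem_packet hX).1 hBX
    exact (lexLT_erase ha hb).2 (h a ha b hb hA hB hlt)

theorem Good.antilexOn {J U : Finset (Finset (Fin n))} {l : List (Finset (Fin n))}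
    (h : Good k J U l) {X : Finset (Fin n)} (hX : X ∈ ksets n (k + 1)) (hXU : X ∈ U) :
    AntilexOn k X l := by
  refine (antilexOn_iff_idxOf h.nodup hX).2 fun a ha b hb hal hbl hlt => ?_
  rcases lt_trichotomy a b with h1 | h1 | h1
  · exact h1
  · subst h1; exact absurd hlt (lt_irrefl _)
  · exact absurd hlt (h.lt_of_mem hX hXU hb ha h1 ((h.mem _).1 hbl) ((h.mem _).1 hal)).not_gt

theorem Good.lexOn {J U : Finset (Finset (Fin n))} {l : List (Finset (Fin n))}
    (h : Good k J U l) {X : Finset (Fin n)} (hX : X ∈ ksets n (k + 1)) (hXU : X ∉ U) :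
    LexOn k X l := by
  refine (lexOn_iff_idxOf h.nodup hX).2 fun a ha b hb hal hbl hlt => ?_
  rcases lt_trichotomy a b with h1 | h1 | h1
  · exact absurd hlt (h.lt_of_notMem hX hXU ha hb h1 ((h.mem _).1 hal) ((h.mem _).1 hbl)).not_gt
  · subst h1; exact absurd hlt (lt_irrefl _)
  · exact h1

/-- For `k = 0` a packet has one member and is both lexicographic and antilexicographic; `0 < k`
makes the two exclusive on a full packet. -/
theorem Good.antilexOn_iff (hk : 0 < k) {J U : Finset (Finset (Fin n))}
    {l : List (Finset (Fin n))} (h : Good k J U l) {X : Finset (Fin n)} (hX : X ∈ setF n k J) :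
    AntilexOn k X l ↔ X ∈ U := by
  obtain ⟨hX, hXJ⟩ := mem_setF.1 hX
  refine ⟨fun h' => ?_, h.antilexOn hX⟩
  by_contra hXU
  have hc : 1 < X.card := by rw [mem_ksets.1 hX]; omega
  obtain ⟨a, ha, b, hb, hne⟩ := Finset.one_lt_card.1 hc
  wlog hab : a < b generalizing a b
  · exact this b hb a ha hne.symm (lt_of_le_of_ne (not_lt.1 hab) hne.symm)
  have h1 := (antilexOn_iff_idxOf h.nodup hX).1 h' b hb a ha ((h.mem _).2 (hXJ b hb))
    ((h.mem _).2 (hXJ a ha)) (h.lt_of_notMem hX hXU ha hb hab (hXJ a ha) (hXJ b hb))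
  exact lt_asymm hab h1

/-! ### Realizability of inversion sets and of prefixes -/

/-- The inversion set determined by an enumeration of a realizable set is realizable. -/
theorem Good.realizable {J U : Finset (Finset (Fin n))} {l : List (Finset (Fin n))}
    (h : Good k J U l) (hJ : Realizable n k J) (h1 : setS n k J ⊆ U)
    (h2 : U ⊆ setS n k J ∪ setF n k J) : Realizable n (k + 1) U := by
  have hUk : U ⊆ ksets n (k + 1) := fun X hX => by
    rcases Finset.mem_union.1 (h2 hX) with h | h
    exacts [(mem_setS.1 h).1, (mem_setF.1 h).1]
  -- membership in `U` is reflected by `J` along packets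
  have up : ∀ X ∈ U, ∀ a ∈ X, ∀ b ∈ X, a < b → X.erase b ∈ J → X.erase a ∈ J := by
    intro X hX a ha b hb hab hbJ
    rcases Finset.mem_union.1 (h2 hX) with h | h
    · exact (mem_setS.1 h).2.2.2 a ha b hb hab hbJ
    · exact (mem_setF.1 h).2 a ha
  have down : ∀ X ∈ ksets n (k + 1), X ∉ U → ∀ a ∈ X, ∀ b ∈ X, a < b →
      X.erase a ∈ J → X.erase b ∈ J := by
    intro X hX hXU a ha b hb hab haJ
    rcases hJ.mem_cases hX with h | h | h | h
    · exact absurd (h1 h) hXU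
    · exact (mem_setP.1 h).2.2.2 a ha b hb hab haJ
    · exact (mem_setF.1 h).2 b hb
    · exact absurd haJ ((mem_setE.1 h).2 a ha)
  refine realizable_iff.2 ⟨hUk, fun Y hY a ha b hb c hc hab hbc => ?_⟩
  have hac := hab.trans hbc
  have hk1 : ∀ x ∈ Y, Y.erase x ∈ ksets n (k + 1) := fun x hx => erase_mem_ksets hY hx
  have mem : ∀ {x y}, x ∈ Y → x ≠ y → x ∈ Y.erase y := fun hx hxy =>
    Finset.mem_erase.2 ⟨hxy, hx⟩
  have comm : ∀ x y, (Y.erase x).erase y = (Y.erase y).erase x := fun x y =>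
    Finset.erase_right_comm
  -- the largest member of a packet in `U` lies in `J`
  have ne : ∀ X ∈ U, ∃ x ∈ X, X.erase x ∈ J := by
    intro X hX
    rcases Finset.mem_union.1 (h2 hX) with h | h
    · exact (mem_setS.1 h).2.1
    · have hne : X.Nonempty := by
        rw [← Finset.card_pos, mem_ksets.1 (mem_setF.1 h).1]; omega
      obtain ⟨x, hx⟩ := hne
      exact ⟨x, hx, (mem_setF.1 h).2 x hx⟩
  -- Deleting the minimum `m` gives the lexicographically last member of each packet `P_{Y∖x}`, `x ≠
  -- m`. It lies in `J` if `Y∖x ∈ U`, and not if `Y∖x ∉ U` and the packet has a member outside `J`.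
  -- The sets `Y∖{x,m}` form the packet of `Y∖m`, to which realizability of `J` applies.
  set m := Y.min' ⟨a, ha⟩ with hm
  have hmY : m ∈ Y := Y.min'_mem _
  have hmle : ∀ x ∈ Y, m ≤ x := fun x hx => Y.min'_le x hx
  have hmin : ∀ x ∈ Y, x ≠ m → Y.erase x ∈ U → (Y.erase x).erase m ∈ J := by
    intro x hx hxm hU
    obtain ⟨z, hz, hzJ⟩ := ne _ hU
    rcases (hmle z (Finset.mem_of_mem_erase hz)).eq_or_lt with h | h
    · rwa [h]
    · exact up _ hU m (mem hmY hxm.symm) z hz h hzJ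
  have hmin' : ∀ x ∈ Y, x ≠ m → Y.erase x ∉ U → ∀ z ∈ Y.erase x, (Y.erase x).erase z ∉ J →
      (Y.erase x).erase m ∉ J := by
    intro x hx hxm hU z hz hzJ hmJ
    rcases (hmle z (Finset.mem_of_mem_erase hz)).eq_or_lt with h | h
    · exact hzJ (h ▸ hmJ)
    · exact hzJ (down _ (hk1 x hx) hU m (mem hmY hxm.symm) z hz h hmJ)
  have hbm : b ≠ m := ((hmle a ha).trans_lt hab).ne'
  have hcm : c ≠ m := ((hmle a ha).trans_lt hac).ne'
  have hreal := fun ham : a ≠ m =>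
    (realizable_iff.1 hJ).2 (Y.erase m) (hk1 m hmY) a (mem ha ham) b (mem hb hbm) c (mem hc hcm)
      hab hbc
  constructor
  · intro hA hC
    by_contra hB
    -- If `Y∖{a,b}` is in `J`, so are `Y∖{a,c}` and `Y∖{b,c}`, and the word would have to order
    -- these three cyclically. Otherwise the deletions of `m` from `Y∖a`, `Y∖b`, `Y∖c` give the
    -- contradiction. The second half is the same with `U` and its complement exchanged.
    by_cases hJ1 : (Y.erase a).erase b ∈ J
    · have hJ2 : (Y.erase b).erase c ∈ J := by
        refine down _ (hk1 b hb) hB a (mem ha hab.ne) c (mem hc hbc.ne') hac ?_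
        rwa [comm]
      have hJ3 : (Y.erase c).erase a ∈ J := by
        refine up _ hC a (mem ha hac.ne) b (mem hb hbc.ne) hab ?_
        rwa [comm]
      have i1 := h.lt_of_mem (hk1 a ha) hA (mem hb hab.ne') (mem hc hac.ne') hbc hJ1
        (by rwa [comm])
      have i2 := h.lt_of_notMem (hk1 b hb) hB (mem ha hab.ne) (mem hc hbc.ne') hac
        (by rwa [comm]) hJ2
      have i3 := h.lt_of_mem (hk1 c hc) hC (mem ha hac.ne) (mem hb hbc.ne) hab hJ3
        (by rwa [comm])
      rw [comm c a, comm c b] at i3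
      rw [comm b a] at i2
      omega
    · have hJ2 : (Y.erase a).erase c ∉ J := fun h =>
        hJ1 (up _ hA b (mem hb hab.ne') c (mem hc hac.ne') hbc h)
      by_cases ham : a = m
      · exact hJ2 (by rw [comm, ham]; exact hmin c hc hcm hC)
      · have h1 := hmin a ha ham hA
        have h2 := hmin c hc hcm hC
        have h3 := hmin' b hb hbm hB a (mem ha hab.ne) (by rwa [comm])
        rw [comm] at h1 h2 h3
        exact h3 ((hreal ham).1 h1 h2)
  · intro hB
    by_contra hAC
    push Not at hAC
    obtain ⟨hA, hC⟩ := hAC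
    by_cases hJ1 : (Y.erase a).erase b ∈ J
    · have hJ2 : (Y.erase a).erase c ∈ J :=
        down _ (hk1 a ha) hA b (mem hb hab.ne') c (mem hc hac.ne') hbc hJ1
      have hJ3 : (Y.erase c).erase b ∈ J := by
        refine down _ (hk1 c hc) hC a (mem ha hac.ne) b (mem hb hbc.ne) hab ?_
        rwa [comm]
      have i1 := h.lt_of_notMem (hk1 a ha) hA (mem hb hab.ne') (mem hc hac.ne') hbc hJ1 hJ2
      have i2 := h.lt_of_mem (hk1 b hb) hB (mem ha hab.ne) (mem hc hbc.ne') hac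
        (by rwa [comm]) (by rwa [comm])
      have i3 := h.lt_of_notMem (hk1 c hc) hC (mem ha hac.ne) (mem hb hbc.ne) hab
        (by rwa [comm]) hJ3
      rw [comm c a, comm c b] at i3
      rw [comm b a] at i2
      omega
    · have hJ2 : (Y.erase b).erase c ∉ J := by
        intro h
        refine hJ1 ?_
        rw [comm]
        exact up _ hB a (mem ha hab.ne) c (mem hc hbc.ne') hac h
      by_cases ham : a = m
      · exact hJ1 (by rw [comm, ham]; exact hmin b hb hbm hB)
      · have h1 := hmin b hb hbm hB
        have h2 := hmin' c hc hcm hC b (mem hb hbc.ne) (by rwa [comm])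
        have h3 := hmin' a ha ham hA b (mem hb hab.ne') hJ1
        rw [comm] at h1 h2 h3
        exact ((hreal ham).2 h1).elim h3 h2

/-- The prefixes of a compatible enumeration of a realizable set are realizable. -/
theorem Good.realizable_take {J U : Finset (Finset (Fin n))} {l : List (Finset (Fin n))}
    (h : Good k J U l) (hJ : Realizable n k J) (h1 : setS n k J ⊆ U)
    (h2 : U ⊆ setS n k J ∪ setF n k J) (i : ℕ) : Realizable n k (l.take i).toFinset := by
  have sub : ∀ A ∈ (l.take i).toFinset, A ∈ J := fun A hA =>
    (h.mem A).1 (List.mem_of_mem_take (List.mem_toFinset.1 hA))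
  have mem : ∀ {A}, A ∈ J → (A ∈ (l.take i).toFinset ↔ l.idxOf A < i) := fun hA => by
    rw [List.mem_toFinset, mem_take_iff_idxOf i ((h.mem _).2 hA)]
  -- If `X ∈ U`, then `J` meets `P_X` in a suffix or in all of it, listed antilexicographically, so
  -- a truncation again meets `P_X` in a suffix, possibly empty or full. If `X ∉ U`, the same holds
  -- with prefixes and the lexicographic order.
  refine realizable_iff.2 ⟨fun A hA => hJ.1 (sub A hA), fun X hX a ha b hb c hc hab hbc => ?_⟩
  have hreal := (realizable_iff.1 hJ).2 X hX a ha b hb c hc hab hbc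
  constructor
  · intro hA hC
    have hAJ := sub _ hA
    have hCJ := sub _ hC
    have hBJ := hreal.1 hAJ hCJ
    rw [mem hAJ] at hA
    rw [mem hCJ] at hC
    rw [mem hBJ]
    by_cases hXU : X ∈ U
    · have := h.lt_of_mem hX hXU hb hc hbc hBJ hCJ
      omega
    · have := h.lt_of_notMem hX hXU ha hb hab hAJ hBJ
      omega
  · intro hB
    have hBJ := sub _ hB
    rw [mem hBJ] at hB
    by_cases hXU : X ∈ U
    · left
      have hAJ : X.erase a ∈ J := by
        rcases Finset.mem_union.1 (h2 hXU) with h | h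
        · exact (mem_setS.1 h).2.2.2 a ha b hb hab hBJ
        · exact (mem_setF.1 h).2 a ha
      rw [mem hAJ]
      exact (h.lt_of_mem hX hXU ha hb hab hAJ hBJ).trans hB
    · right
      have hCJ : X.erase c ∈ J := by
        rcases hJ.mem_cases hX with h | h | h | h
        · exact absurd (h1 h) hXU
        · exact (mem_setP.1 h).2.2.2 b hb c hc hbc hBJ
        · exact (mem_setF.1 h).2 c hc
        · exact absurd hBJ ((mem_setE.1 h).2 b hb)
      rw [mem hCJ]
      exact (h.lt_of_notMem hX hXU hb hc hbc hBJ hCJ).trans hB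

/-- An enumeration of `J` with realizable prefixes is compatible with its inversion set. -/
theorem good_of_realizable_take {J : Finset (Finset (Fin n))} {l : List (Finset (Fin n))}
    (hl : l.Nodup) (hlJ : ∀ A, A ∈ l ↔ A ∈ J) (hJ : Realizable n k J)
    (hr : ∀ i, Realizable n k (l.take i).toFinset) :
    Good k J ((setF n k J).filter (fun X => AntilexOn k X l) ∪ setS n k J) l := by
  refine ⟨hl, hlJ, (pairwise_iff_idxOf hl).2 fun A hA B hB hAB harr => ?_⟩
  obtain ⟨X, hX, b, hb, a, ha, rfl, rfl, h⟩ := harr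
  have hne : b ≠ a := by rcases h with h | h; exacts [h.1.ne', h.1.ne]
  -- at the time when `X.erase x` occurs, exactly the earlier letters are present
  have hmid : ∀ x ∈ X, ∀ y ∈ X, ∀ z ∈ X, x < y → y < z → X.erase y ∈ l →
      (X.erase x ∈ l → l.idxOf (X.erase y) < l.idxOf (X.erase x)) →
      (X.erase z ∈ l → l.idxOf (X.erase y) < l.idxOf (X.erase z)) → False := by
    intro x hx y hy z hz hxy hyz hyl h1 h2
    have := ((realizable_iff.1 (hr (l.idxOf (X.erase y) + 1))).2 X hX x hx y hy z hz hxy hyz).2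
      -- The `+ 1` makes the prefix end with `X.erase y` itself: a middle deletion cannot be the
      -- first of the three to appear.
      (by rw [List.mem_toFinset, mem_take_iff_idxOf _ hyl]; omega)
    rw [List.mem_toFinset, List.mem_toFinset] at this
    rcases this with h | h
    · have hm := List.mem_of_mem_take h
      rw [mem_take_iff_idxOf _ hm] at h
      have := h1 hm
      omega
    · have hm := List.mem_of_mem_take h
      rw [mem_take_iff_idxOf _ hm] at h
      have := h2 hm
      omega
  have hmid' : ∀ x ∈ X, ∀ y ∈ X, ∀ z ∈ X, x < y → y < z → X.erase x ∈ l → X.erase z ∈ l →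
      (X.erase y ∈ l → l.idxOf (X.erase x) < l.idxOf (X.erase y)) →
      (X.erase y ∈ l → l.idxOf (X.erase z) < l.idxOf (X.erase y)) → False := by
    intro x hx y hy z hz hxy hyz hxl hzl h1 h2
    -- The prefix ends with the later of the two outer deletions: a middle deletion cannot be the
    -- last of the three.
    have := ((realizable_iff.1 (hr (max (l.idxOf (X.erase x)) (l.idxOf (X.erase z)) + 1))).2
      X hX x hx y hy z hz hxy hyz).1
      (by rw [List.mem_toFinset, mem_take_iff_idxOf _ hxl]; omega)
      (by rw [List.mem_toFinset, mem_take_iff_idxOf _ hzl]; omega)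
    rw [List.mem_toFinset] at this
    have hm := List.mem_of_mem_take this
    rw [mem_take_iff_idxOf _ hm] at this
    have := h1 hm
    have := h2 hm
    omega
  by_cases hF : X ∈ setF n k J
  · have hXl : ∀ x ∈ X, X.erase x ∈ l := fun x hx => (hlJ _).2 ((mem_setF.1 hF).2 x hx)
    have hiff : X ∈ (setF n k J).filter (fun X => AntilexOn k X l) ∪ setS n k J ↔
        AntilexOn k X l := by
      rw [Finset.mem_union, Finset.mem_filter]
      refine ⟨fun h => ?_, fun h => .inl ⟨hF, h⟩⟩
      rcases h with h | h
      · exact h.2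
      · obtain ⟨x, hx, hxJ⟩ := (mem_setS.1 h).2.2.1
        exact absurd ((mem_setF.1 hF).2 x hx) hxJ
    rw [hiff] at h
    rcases h with ⟨hab, hn⟩ | ⟨hba, hanti⟩
    · rw [antilexOn_iff_idxOf hl hX] at hn
      push Not at hn
      obtain ⟨c, hc, d, hd, -, -, hcd, hle⟩ := hn
      have hdc : d < c := lt_of_le_of_ne hle (by rintro rfl; exact lt_irrefl _ hcd)
      -- the letter of the packet that comes first
      obtain ⟨f, hf, hmin⟩ := X.exists_min_image (fun x => l.idxOf (X.erase x)) ⟨a, ha⟩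
      have hmin' : ∀ x ∈ X, x ≠ f → l.idxOf (X.erase f) < l.idxOf (X.erase x) :=
        fun x hx hxf => lt_of_le_of_ne (hmin x hx)
          (idxOf_ne (hXl f hf) fun h => hxf (erase_injOn hf h).symm)
      have hbf : b ≠ f := by rintro rfl; exact absurd (hmin a ha) (not_le.2 hAB)
      have hdf : d ≠ f := by rintro rfl; exact absurd (hmin c hc) (not_le.2 hcd)
      -- An ascent `a < b` and a descent `c > d` of deleted elements cannot coexist: with `f` first,
      -- either `b` is last among `a < b < f`, or `f` is first among `d < f < b`, or `d` is last
      -- among `f < d < c`.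
      rcases lt_or_gt_of_ne hbf with h1 | h1
      · exact hmid' a ha b hb f hf hab h1 (hXl a ha) (hXl f hf) (fun _ => hAB)
          (fun _ => hmin' b hb hbf)
      rcases lt_or_gt_of_ne hdf with h2 | h2
      · exact hmid d hd f hf b hb h2 h1 (hXl f hf) (fun _ => hmin' d hd hdf)
          (fun _ => hmin' b hb hbf)
      · exact hmid' f hf d hd c hc h2 hdc (hXl f hf) (hXl c hc) (fun _ => hmin' d hd hdf)
          (fun _ => hcd)
    · exact lt_asymm hba ((antilexOn_iff_idxOf hl hX).1 hanti a ha b hb hA hB hAB)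
  · have hiff : X ∈ (setF n k J).filter (fun X => AntilexOn k X l) ∪ setS n k J ↔
        X ∈ setS n k J := by
      rw [Finset.mem_union, Finset.mem_filter]
      tauto
    rw [hiff] at h
    have hAJ := (hlJ _).1 hA
    have hBJ := (hlJ _).1 hB
    -- When the packet is not full, a deletion `z` outside `J` serves as the third element: it never
    -- appears.
    rcases hJ.mem_cases hX with hc | hc | hc | hc
    · obtain ⟨-, -, ⟨z, hz, hzJ⟩, hs⟩ := mem_setS.1 hc
      have hba : b < a := by rcases h with h | h; exacts [absurd hc h.2, h.1]
      have haz : a < z := by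
        rcases lt_trichotomy a z with h | h | h
        · exact h
        · exact absurd hAJ (h ▸ hzJ)
        · exact absurd (hs z hz a ha h hAJ) hzJ
      exact hmid b hb a ha z hz hba haz hA (fun _ => hAB)
        (fun h => absurd ((hlJ _).1 h) hzJ)
    · obtain ⟨-, -, ⟨z, hz, hzJ⟩, hs⟩ := mem_setP.1 hc
      have hza : z < a := by
        rcases lt_trichotomy z a with h | h | h
        · exact h
        · exact absurd hAJ (h ▸ hzJ)
        · exact absurd (hs a ha z hz h hAJ) hzJ
      have hzb : z < b := by
        rcases lt_trichotomy z b with h | h | h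
        · exact h
        · exact absurd hBJ (h ▸ hzJ)
        · exact absurd (hs b hb z hz h hBJ) hzJ
      rcases h with ⟨hab, -⟩ | ⟨-, h⟩
      · exact hmid z hz a ha b hb hza hab hA (fun h => absurd ((hlJ _).1 h) hzJ) (fun _ => hAB)
      · exact hzJ ((mem_setS.1 h).2.2.2 z hz a ha hza hAJ)
    · exact hF hc
    · exact (mem_setE.1 hc).2 a ha hAJ

/-! ### Existence of linear extensions and contiguous packets -/

theorem exists_sorted {α : Type*} [DecidableEq α] (J : Finset α) (f : α → ℕ) :
    ∃ l : List α, l.Nodup ∧ (∀ a, a ∈ l ↔ a ∈ J) ∧ l.Pairwise fun a b => f a ≤ f b := by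
  induction J using Finset.induction_on_max_value f with
  | empty => exact ⟨[], by simp⟩
  | insert a s ha hmax ih =>
    obtain ⟨l, h1, h2, h3⟩ := ih
    refine ⟨l ++ [a], ?_, fun b => ?_, ?_⟩
    · rw [List.nodup_append]
      refine ⟨h1, List.nodup_singleton a, ?_⟩
      rintro b hb c hc rfl
      exact ha ((h2 _).1 (List.mem_singleton.1 hc ▸ hb))
    · simp [h2, or_comm]
    · rw [List.pairwise_append]
      refine ⟨h3, List.pairwise_singleton _ _, fun b hb c hc => ?_⟩
      rw [List.mem_singleton.1 hc]
      exact hmax b ((h2 b).1 hb)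

/-- A realizable set prescribes an acyclic relation, which has a linear extension. -/
theorem Realizable.exists_good {U : Finset (Finset (Fin n))} (hU : Realizable n (k + 1) U)
    (J : Finset (Finset (Fin n))) : ∃ l, Good k J U l := by
  obtain ⟨f, hf⟩ := hU.exists_rank
  obtain ⟨l, h1, h2, h3⟩ := exists_sorted J f
  exact ⟨l, h1, h2, h3.imp fun h h' => h.not_gt (hf _ _ h')⟩

/-- An arrow is decided by a packet containing both sets, so adding `X` to `U` matters only inside
`P_X`. -/
theorem arrow_insert {U : Finset (Finset (Fin n))} {X A B : Finset (Fin n)}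
    (h : ¬ (A ∈ packet k X ∧ B ∈ packet k X)) :
    Arrow k (insert X U) A B ↔ Arrow k U A B := by
  have key : ∀ Y ∈ ksets n (k + 1), ∀ a ∈ Y, ∀ b ∈ Y, A = Y.erase a → B = Y.erase b →
      (Y ∈ insert X U ↔ Y ∈ U) := by
    rintro Y hY a ha b hb rfl rfl
    have hYX : Y ≠ X := by
      rintro rfl
      exact h ⟨(mem_packet hY).2 ⟨a, ha, rfl⟩, (mem_packet hY).2 ⟨b, hb, rfl⟩⟩
    simp [hYX]
  constructor
  · rintro ⟨Y, hY, a, ha, b, hb, h1, h2, h3⟩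
    rw [key Y hY a ha b hb h1 h2] at h3
    exact ⟨Y, hY, a, ha, b, hb, h1, h2, h3⟩
  · rintro ⟨Y, hY, a, ha, b, hb, h1, h2, h3⟩
    rw [← key Y hY a ha b hb h1 h2] at h3
    exact ⟨Y, hY, a, ha, b, hb, h1, h2, h3⟩

/-- If both `U` and `U ∪ {X}` are realizable, then some linear extension for `U` contains the
packet of `X` as a contiguous block. -/
theorem Realizable.exists_good_block {U J : Finset (Finset (Fin n))} {X : Finset (Fin n)}
    (hU : Realizable n (k + 1) U) (hU' : Realizable n (k + 1) (insert X U))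
    (hX : X ∈ setF n k J) (hXU : X ∉ U) :
    ∃ u w v, Good k J U (u ++ w ++ v) ∧ ∀ A, A ∈ w ↔ A ∈ packet k X := by
  classical
  obtain ⟨hX, hXJ⟩ := mem_setF.1 hX
  obtain ⟨f, hf⟩ := hU.exists_rank
  obtain ⟨f', hf'⟩ := hU'.exists_rank
  -- `D` collects the sets forced to precede `P_X`: those with a chain of arrows into it that stays
  -- outside until its last term. Such chains are valid for both `U` and `insert X U`.
  let R : Finset (Fin n) → Finset (Fin n) → Prop := fun A B => A ∉ packet k X ∧ Arrow k U A B
  let D : Finset (Fin n) → Prop := fun A => ∃ B ∈ packet k X, Relation.TransGen R A B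
  have hDf : ∀ A B, Relation.TransGen R A B → f A < f B ∧ f' A < f' B := by
    intro A B h
    have hstep : ∀ A B, R A B → f A < f B ∧ f' A < f' B := fun A B h =>
      ⟨hf _ _ h.2, hf' _ _ ((arrow_insert fun h' => h.1 h'.1).2 h.2)⟩
    induction h with
    | single h => exact hstep _ _ h
    | tail _ h ih => exact ⟨ih.1.trans (hstep _ _ h).1, ih.2.trans (hstep _ _ h).2⟩
  have hDX : ∀ A, D A → A ∉ packet k X := by
    rintro A ⟨B, -, h⟩
    obtain ⟨C, h, -⟩ := Relation.TransGen.head'_iff.1 h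
    exact h.1
  have hDdown : ∀ A B, Arrow k U A B → D B → A ∉ packet k X → D A :=
    fun A B h ⟨C, hC, hBC⟩ hA => ⟨C, hC, Relation.TransGen.head ⟨hA, h⟩ hBC⟩
  have hDpacket : ∀ A B, Arrow k U A B → B ∈ packet k X → A ∉ packet k X → D A :=
    fun A B h hB hA => ⟨B, hB, Relation.TransGen.single ⟨hA, h⟩⟩
  -- An arrow from `P_X` into `D` would give a chain leaving and re-entering `P_X`, ordering its
  -- endpoints identically for `U` and `insert X U`. These prescribe opposite orders on `P_X`, and
  -- acyclicity of both excludes equal endpoints too.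
  have hconv : ∀ A ∈ packet k X, ∀ B, D B → ¬ Arrow k U A B := by
    rintro A hA B hB h
    have hBX := hDX B hB
    obtain ⟨C, hC, hBC⟩ := hB
    obtain ⟨h1, h2⟩ := hDf _ _ hBC
    have h3 := (hf _ _ h).trans h1
    have h4 := (hf' _ _ ((arrow_insert fun h' => hBX h'.2).2 h)).trans h2
    obtain ⟨a, ha, rfl⟩ := (mem_packet hX).1 hA
    obtain ⟨c, hc, rfl⟩ := (mem_packet hX).1 hC
    rcases lt_trichotomy a c with h | h | h
    · exact h3.not_gt (hf _ _ ((arrow_erase hX hc ha h.ne').2 (.inl ⟨h, hXU⟩)))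
    · subst h; exact lt_irrefl _ h3
    · exact h4.not_gt (hf' _ _ ((arrow_erase hX hc ha h.ne).2
        (.inr ⟨h, Finset.mem_insert_self _ _⟩)))
  clear_value D
  have hsort : ∀ K : Finset (Finset (Fin n)), ∃ l, Good k K U l := hU.exists_good
  obtain ⟨u, hu⟩ := hsort (J.filter D)
  obtain ⟨w, hw⟩ := hsort (packet k X)
  obtain ⟨v, hv⟩ := hsort (J.filter fun A => ¬ D A ∧ A ∉ packet k X)
  have hPJ : ∀ A ∈ packet k X, A ∈ J := by
    intro A hA
    obtain ⟨a, ha, rfl⟩ := (mem_packet hX).1 hA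
    exact hXJ a ha
  refine ⟨u, w, v, ⟨?_, fun A => ?_, ?_⟩, hw.mem⟩
  · rw [List.nodup_append, List.nodup_append]
    refine ⟨⟨hu.nodup, hw.nodup, ?_⟩, hv.nodup, ?_⟩
    · rintro A hA B hB rfl
      rw [hu.mem, Finset.mem_filter] at hA
      rw [hw.mem] at hB
      exact hDX A hA.2 hB
    · rintro A hA B hB rfl
      rw [List.mem_append, hu.mem, hw.mem, Finset.mem_filter] at hA
      rw [hv.mem, Finset.mem_filter] at hB
      tauto
  · rw [List.mem_append, List.mem_append, hu.mem, hw.mem, hv.mem, Finset.mem_filter,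
      Finset.mem_filter]
    have := hPJ A
    tauto
  · rw [List.pairwise_append, List.pairwise_append]
    refine ⟨⟨hu.pairwise, hw.pairwise, ?_⟩, hv.pairwise, ?_⟩
    · intro A hA B hB
      rw [hu.mem, Finset.mem_filter] at hA
      rw [hw.mem] at hB
      exact hconv B hB A hA.2
    · intro A hA B hB h
      rw [List.mem_append, hu.mem, hw.mem, Finset.mem_filter] at hA
      rw [hv.mem, Finset.mem_filter] at hB
      rcases hA with hA | hA
      · exact hB.2.1 (hDdown _ _ h hA.2 hB.2.2)
      · exact hB.2.1 (hDpacket _ _ h hA hB.2.2)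

/-- Reversing a contiguous packet adds it to the inversion set. -/
theorem Good.reverse {U J : Finset (Finset (Fin n))} {X : Finset (Fin n)}
    {u w v : List (Finset (Fin n))} (h : Good k J U (u ++ w ++ v)) (hX : X ∈ ksets n (k + 1))
    (hXU : X ∉ U) (hw : ∀ A, A ∈ w ↔ A ∈ packet k X) :
    Good k J (insert X U) (u ++ w.reverse ++ v) := by
  have hperm : (u ++ w.reverse ++ v).Perm (u ++ w ++ v) :=
    ((List.reverse_perm w).append_left u).append_right v
  refine ⟨hperm.nodup_iff.2 h.nodup, fun A => hperm.mem_iff.trans (h.mem A), ?_⟩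
  have hn := h.nodup
  have hp := h.pairwise
  rw [List.nodup_append, List.nodup_append] at hn
  obtain ⟨⟨-, hwn, huw⟩, -, huwv⟩ := hn
  have hu : ∀ A ∈ u, A ∉ packet k X := fun A hA hAX => huw A hA A ((hw A).2 hAX) rfl
  have hv : ∀ A ∈ v, A ∉ packet k X := fun A hA hAX =>
    huwv A (List.mem_append_right _ ((hw A).2 hAX)) A hA rfl
  rw [List.pairwise_append, List.pairwise_append] at hp ⊢
  obtain ⟨⟨pu, pw, puw⟩, pv, puwv⟩ := hp
  refine ⟨⟨pu.imp_of_mem fun {A B} hA hB h => ?_, ?_, fun A hA B hB => ?_⟩,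
    pv.imp_of_mem fun {A B} hA hB h => ?_, fun A hA B hB => ?_⟩
  · rwa [arrow_insert fun h => hu A hA h.2]
  · rw [List.pairwise_reverse]
    refine (pw.and hwn).imp_of_mem fun {A B} hA hB ⟨h, hne⟩ => ?_
    obtain ⟨a, ha, rfl⟩ := (mem_packet hX).1 ((hw _).1 hA)
    obtain ⟨b, hb, rfl⟩ := (mem_packet hX).1 ((hw _).1 hB)
    have hab : a ≠ b := fun h => hne (h ▸ rfl)
    rw [arrow_erase hX hb ha hab.symm] at h
    rw [arrow_erase hX ha hb hab]
    have := Finset.mem_insert_self X U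
    rcases lt_or_gt_of_ne hab with h' | h'
    · exact absurd (.inl ⟨h', hXU⟩) h
    · rintro (h | h)
      · exact h.2 this
      · exact lt_asymm h.1 h'
  · rw [arrow_insert fun h => hu A hA h.2]
    exact puw A hA B (List.mem_reverse.1 hB)
  · rwa [arrow_insert fun h => hv A hA h.2]
  · rw [arrow_insert fun h => hv B hB h.1]
    refine puwv A ?_ B hB
    simpa using hA

/-! ### Interchanges connect linear extensions -/

theorem SwapStep.cons {l l' : List (Finset (Fin n))} (h : SwapStep k l l') (C : Finset (Fin n)) :
    SwapStep k (C :: l) (C :: l') := by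
  obtain ⟨u, v, A, B, rfl, rfl, h⟩ := h
  exact ⟨C :: u, v, A, B, rfl, rfl, h⟩

theorem swapSteps_to_front (A : Finset (Fin n)) (v : List (Finset (Fin n))) :
    ∀ u : List (Finset (Fin n)), (∀ C ∈ u, ¬ SharePacket k A C) →
      Relation.ReflTransGen (SwapStep k) (A :: (u ++ v)) (u ++ A :: v)
  | [], _ => .refl
  | C :: u, h => by
    have ih := swapSteps_to_front A v u fun D hD => h D (List.mem_cons_of_mem _ hD)
    have ih' := ih.lift (p := SwapStep k) (C :: ·) fun _ _ h => h.cons C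
    exact Relation.ReflTransGen.head
      ⟨[], u ++ v, A, C, rfl, rfl, h C (List.mem_cons_self ..)⟩ ih'

/-- Two linear extensions of the same relation are connected by interchanges of unrelated
neighbours. -/
theorem swapSteps_of_pairwise {U : Finset (Finset (Fin n))} :
    ∀ l l' : List (Finset (Fin n)), l.Nodup → l.Perm l' →
      l.Pairwise (fun A B => ¬ Arrow k U B A) → l'.Pairwise (fun A B => ¬ Arrow k U B A) →
      Relation.ReflTransGen (SwapStep k) l l'
  | [], l', _, hp, _, _ => by rw [List.nil_perm.1 hp]
  | A :: t, l', hn, hp, h, h' => by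
    obtain ⟨u, v, rfl⟩ := List.append_of_mem (hp.subset (List.mem_cons_self ..))
    have hp' : t.Perm (u ++ v) := (hp.trans List.perm_middle).cons_inv
    have hn' := hn
    rw [List.nodup_cons] at hn'
    rw [List.pairwise_cons] at h
    have h'' : (u ++ v).Pairwise (fun A B => ¬ Arrow k U B A) :=
      h'.sublist ((List.sublist_cons_self A v).append_left u)
    have ih := swapSteps_of_pairwise t (u ++ v) hn'.2 hp' h.2 h''
    refine (ih.lift (p := SwapStep k) (A :: ·) fun _ _ h => h.cons A).trans
      (swapSteps_to_front A v u fun C hC hs => ?_)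
    have hCt : C ∈ t := hp'.mem_iff.2 (List.mem_append_left _ hC)
    have hne : A ≠ C := by rintro rfl; exact hn'.1 hCt
    -- `C` comes before `A` in `l'` and after it in `l`, so neither arrow is allowed, whereas
    -- members of a common packet always have one.
    rcases hs.arrow_or hne U with h1 | h1
    · exact (List.pairwise_append.1 h').2.2 C hC A (List.mem_cons_self ..) h1
    · exact h.1 C hCt h1

theorem Good.swapSteps {J U : Finset (Finset (Fin n))} {l l' : List (Finset (Fin n))}
    (h : Good k J U l) (h' : Good k J U l') : Relation.ReflTransGen (SwapStep k) l l' :=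
  swapSteps_of_pairwise l l' h.nodup
    ((List.perm_ext_iff_of_nodup h.nodup h'.nodup).2 fun A => (h.mem A).trans (h'.mem A).symm)
    h.pairwise h'.pairwise

theorem Good.of_swapStep {J U : Finset (Finset (Fin n))} {l l' : List (Finset (Fin n))}
    (h : Good k J U l) (hs : SwapStep k l l') : Good k J U l' := by
  obtain ⟨u, v, A, B, rfl, rfl, hAB⟩ := hs
  have hperm : (u ++ B :: A :: v).Perm (u ++ A :: B :: v) :=
    (List.Perm.swap A B v).append_left u
  refine ⟨hperm.nodup_iff.2 h.nodup, fun C => hperm.mem_iff.trans (h.mem C), ?_⟩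
  have hp := h.pairwise
  simp only [List.pairwise_append, List.pairwise_cons, List.mem_cons] at hp ⊢
  refine ⟨hp.1, ⟨?_, ?_, hp.2.1.2.2⟩, ?_⟩
  · rintro C (rfl | hC)
    · exact fun h => hAB h.sharePacket
    · exact hp.2.1.2.1 C hC
  · exact fun C hC => hp.2.1.1 C (.inr hC)
  · intro C hC D hD
    exact hp.2.2 C hC D (by tauto)

/-! ### `B(n,k)` as the realizable `(k+1)`-sets -/

theorem AdmOrder.good (ρ : AdmOrder n k) : Good k (ksets n k) ρ.inv ρ.word := by
  refine ⟨ρ.nodup, ρ.mem_word, (pairwise_iff_idxOf ρ.nodup).2 fun A hA B hB hAB harr => ?_⟩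
  obtain ⟨X, hX, b, hb, a, ha, rfl, rfl, h⟩ := harr
  rw [AdmOrder.inv, Finset.mem_filter] at h
  rcases h with ⟨hab, hn⟩ | ⟨hba, -, hanti⟩
  · have hlex := (ρ.admissible X hX).resolve_right fun h => hn ⟨hX, h⟩
    exact lt_asymm hab ((lexOn_iff_idxOf ρ.nodup hX).1 hlex a ha b hb hA hB hAB)
  · exact lt_asymm hba ((antilexOn_iff_idxOf ρ.nodup hX).1 hanti a ha b hb hA hB hAB)

/-- A word compatible with some relation, as an admissible order. -/
def Good.admOrder {U : Finset (Finset (Fin n))} {l : List (Finset (Fin n))}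
    (h : Good k (ksets n k) U l) : AdmOrder n k where
  word := l
  nodup := h.nodup
  mem_word := h.mem
  admissible X hX := by
    by_cases hXU : X ∈ U
    · exact .inr (h.antilexOn hX hXU)
    · exact .inl (h.lexOn hX hXU)

theorem Good.inv_eq_of_ksets (hk : 0 < k) {U : Finset (Finset (Fin n))} (hU : U ⊆ ksets n (k + 1))
    {ρ : AdmOrder n k} (h : Good k (ksets n k) U ρ.word) : ρ.inv = U := by
  ext X
  rw [AdmOrder.inv, Finset.mem_filter]
  constructor
  · rintro ⟨hX, h'⟩
    exact (h.antilexOn_iff hk (setF_ksets ▸ hX)).1 h'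
  · exact fun hX => ⟨hU hX, h.antilexOn (hU hX) hX⟩

theorem AdmOrder.word_injective {ρ ρ' : AdmOrder n k} (h : ρ.word = ρ'.word) : ρ = ρ' := by
  cases ρ; cases ρ'; cases h; rfl

/-- Swaps act on arbitrary words; each intermediate word is still a linear extension for `ρ.inv`,
hence an admissible order, so the swaps descend to the quotient. -/
theorem AdmOrder.mk_eq_of_swapSteps (ρ : AdmOrder n k) {l : List (Finset (Fin n))}
    (h : Relation.ReflTransGen (SwapStep k) ρ.word l) :
    Good k (ksets n k) ρ.inv l ∧ ∀ ρ' : AdmOrder n k, ρ'.word = l →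
      (Quot.mk _ ρ : B n k) = Quot.mk _ ρ' := by
  induction h with
  | refl => exact ⟨ρ.good, fun ρ' h => by rw [AdmOrder.word_injective h]⟩
  | tail _ hs ih =>
    refine ⟨ih.1.of_swapStep hs, fun ρ' h => ?_⟩
    subst h
    exact (ih.2 ih.1.admOrder rfl).trans (Quot.sound hs)

theorem B.inv_injective : Function.Injective (B.inv (n := n) (k := k)) := by
  rintro ⟨ρ⟩ ⟨ρ'⟩ h
  have h' : ρ.inv = ρ'.inv := h
  exact (ρ.mk_eq_of_swapSteps (ρ.good.swapSteps (h' ▸ ρ'.good))).2 ρ' rfl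

theorem B.realizable_inv (r : B n k) : Realizable n (k + 1) r.inv := by
  obtain ⟨ρ⟩ := r
  refine ρ.good.realizable realizable_ksets ?_ ?_
  · simp [setS_ksets]
  · rw [setF_ksets]
    exact (Finset.filter_subset _ _).trans Finset.subset_union_right

theorem B.exists_inv_eq (hk : 0 < k) {U : Finset (Finset (Fin n))} (hU : Realizable n (k + 1) U) :
    ∃ r : B n k, r.inv = U := by
  obtain ⟨l, hl⟩ := hU.exists_good (ksets n k)
  exact ⟨Quot.mk _ hl.admOrder, Good.inv_eq_of_ksets hk hU.1 (ρ := hl.admOrder) hl⟩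

theorem B.FlipUp.inv_eq (hk : 0 < k) {X : Finset (Fin n)} {r r' : B n k} (h : B.FlipUp X r r') :
    X ∉ r.inv ∧ r'.inv = insert X r.inv := by
  obtain ⟨hX, ρ, ρ', rfl, rfl, hXρ, u, w, v, h1, h2, hw⟩ := h
  refine ⟨hXρ, ?_⟩
  have hg := ρ.good
  rw [h1] at hg
  have hg' := hg.reverse hX hXρ hw
  rw [← h2] at hg'
  exact hg'.inv_eq_of_ksets hk (Finset.insert_subset hX (Finset.filter_subset _ _))

theorem B.exists_flipUp (hk : 0 < k) {X : Finset (Fin n)} {r : B n k} (hX : X ∉ r.inv)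
    (h : Realizable n (k + 1) (insert X r.inv)) :
    ∃ r' : B n k, B.FlipUp X r r' ∧ r'.inv = insert X r.inv := by
  have hXk : X ∈ ksets n (k + 1) := h.1 (Finset.mem_insert_self _ _)
  obtain ⟨u, w, v, hg, hw⟩ := r.realizable_inv.exists_good_block h
    (setF_ksets (k := k) ▸ hXk) hX
  have hg' := hg.reverse hXk hX hw
  have e1 : hg.admOrder.inv = r.inv :=
    Good.inv_eq_of_ksets hk r.realizable_inv.1 (ρ := hg.admOrder) hg
  have e2 : hg'.admOrder.inv = insert X r.inv :=
    Good.inv_eq_of_ksets hk h.1 (ρ := hg'.admOrder) hg'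
  exact ⟨Quot.mk _ hg'.admOrder, ⟨hXk, hg.admOrder, hg'.admOrder, B.inv_injective e1, rfl,
    by rwa [e1], u, w, v, rfl, rfl, hw⟩, e2⟩

/-! ### Paths as words with realizable prefixes -/

/-- Each flip adds its `X` to the inversion set, so the inversion sets along the chain are `r.inv`
joined with the prefixes of the word. -/
theorem IsFlipChain.spec (hm : 0 < m) : ∀ {st : List (Finset (Fin n) × B n m)} {r s : B n m},
    IsFlipChain r st s → (st.map Prod.fst).Nodup ∧ (∀ A ∈ st.map Prod.fst, A ∉ r.inv) ∧
      s.inv = r.inv ∪ (st.map Prod.fst).toFinset ∧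
      ∀ i, Realizable n (m + 1) (r.inv ∪ ((st.map Prod.fst).take i).toFinset)
  | [], r, s, h => by
    cases h
    simp [r.realizable_inv]
  | (X, t) :: st, r, s, h => by
    obtain ⟨hf, hc⟩ := h
    obtain ⟨hX, ht⟩ := hf.inv_eq hm
    obtain ⟨h1, h2, h3, h4⟩ := IsFlipChain.spec hm hc
    rw [ht] at h2 h3
    simp only [List.map_cons, List.nodup_cons, List.mem_cons]
    refine ⟨⟨fun h => h2 X h (Finset.mem_insert_self _ _), h1⟩, ?_, ?_, fun i => ?_⟩
    · rintro A (rfl | hA)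
      · exact hX
      · exact fun h => h2 A hA (Finset.mem_insert_of_mem h)
    · rw [h3, List.toFinset_cons, Finset.insert_union, Finset.union_insert]
    · cases i with
      | zero => simpa using r.realizable_inv
      | succ i =>
        have := h4 i
        rwa [ht, Finset.insert_union, ← Finset.union_insert, ← List.toFinset_cons,
          ← List.take_succ_cons] at this

theorem exists_isFlipChain (hm : 0 < m) : ∀ (l : List (Finset (Fin n))) (r : B n m), l.Nodup →
    (∀ A ∈ l, A ∉ r.inv) → (∀ i, Realizable n (m + 1) (r.inv ∪ (l.take i).toFinset)) →
    ∃ st s, st.map Prod.fst = l ∧ IsFlipChain r st s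
  | [], r, _, _, _ => ⟨[], r, rfl, rfl⟩
  | X :: l, r, hn, hd, hr => by
    rw [List.nodup_cons] at hn
    have h1 := hr 1
    rw [List.take_succ_cons, List.take_zero, List.toFinset_cons, Finset.union_insert] at h1
    simp only [List.toFinset_nil, Finset.union_empty] at h1
    obtain ⟨t, hft, ht⟩ := B.exists_flipUp hm (hd X (List.mem_cons_self ..)) h1
    obtain ⟨st, s, hst, hc⟩ := exists_isFlipChain hm l t hn.2 (fun A hA h => by
        rw [ht, Finset.mem_insert] at h
        rcases h with rfl | h
        · exact hn.1 hA
        · exact hd A (List.mem_cons_of_mem _ hA) h) fun i => by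
      have := hr (i + 1)
      rwa [List.take_succ_cons, List.toFinset_cons, Finset.union_insert, ← Finset.insert_union,
        ← ht] at this
    exact ⟨(X, t) :: st, s, by rw [List.map_cons, hst], hft, hc⟩

/-- The flipped sets determine all intermediate inversion sets, and these determine the elements of
`B n m`. Paths may thus be replaced by their words. -/
theorem IsFlipChain.unique (hm : 0 < m) : ∀ {st st' : List (Finset (Fin n) × B n m)}
    {r s s' : B n m}, IsFlipChain r st s → IsFlipChain r st' s' →
      st.map Prod.fst = st'.map Prod.fst → st = st' ∧ s = s'
  | [], [], _, _, _, h, h', _ => ⟨rfl, h.symm.trans h'⟩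
  | (X, t) :: st, (X', t') :: st', r, s, s', h, h', hw => by
    rw [List.map_cons, List.map_cons, List.cons.injEq] at hw
    obtain ⟨hX, hw⟩ := hw
    obtain rfl : X = X' := hX
    obtain rfl : t = t' :=
      B.inv_injective ((h.1.inv_eq hm).2.trans (h'.1.inv_eq hm).2.symm)
    obtain ⟨rfl, rfl⟩ := IsFlipChain.unique hm h.2 h'.2 hw
    exact ⟨rfl, rfl⟩

variable {J : Finset (Finset (Fin n))}

theorem FlipPath.word_injective (hm : 0 < m) {γ γ' : FlipPath n m ∅ J}
    (h : γ.word = γ'.word) : γ = γ' := by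
  obtain ⟨r, st, s, hc, h1, h2⟩ := γ
  obtain ⟨r', st', s', hc', h1', h2'⟩ := γ'
  obtain rfl : r = r' := B.inv_injective (h1.trans h1'.symm)
  obtain ⟨rfl, rfl⟩ := hc.unique hm hc' h
  rfl

theorem FlipPath.good (hm : 0 < m) (hJ : Realizable n (m + 1) J) (γ : FlipPath n m ∅ J) :
    Good (m + 1) J γ.inv γ.word := by
  obtain ⟨h1, -, h3, h4⟩ := γ.chain.spec hm
  rw [γ.inv_src, γ.inv_tgt, Finset.empty_union] at h3
  simp only [γ.inv_src, Finset.empty_union] at h4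
  exact good_of_realizable_take h1 (fun A => (h3 ▸ List.mem_toFinset.symm :)) hJ h4

theorem Good.path_inv_eq {U : Finset (Finset (Fin n))}
    {γ : FlipPath n m ∅ J} (h : Good (m + 1) J U γ.word) (h1 : setS n (m + 1) J ⊆ U)
    (h2 : U ⊆ setS n (m + 1) J ∪ setF n (m + 1) J) : γ.inv = U := by
  ext X
  rw [FlipPath.inv, Finset.mem_union, Finset.mem_filter]
  constructor
  · rintro (⟨hX, h'⟩ | hX)
    · exact (h.antilexOn_iff m.succ_pos hX).1 h'
    · exact h1 hX
  · intro hX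
    rcases Finset.mem_union.1 (h2 hX) with hS | hF
    · exact .inr hS
    · exact .inl ⟨hF, (h.antilexOn_iff m.succ_pos hF).2 hX⟩

theorem Good.exists_path (hm : 0 < m) (hJ : Realizable n (m + 1) J) {U : Finset (Finset (Fin n))}
    {l : List (Finset (Fin n))} (h : Good (m + 1) J U l) (h1 : setS n (m + 1) J ⊆ U)
    (h2 : U ⊆ setS n (m + 1) J ∪ setF n (m + 1) J) :
    ∃ γ : FlipPath n m ∅ J, γ.word = l ∧ γ.inv = U := by
  have hr := h.realizable_take hJ h1 h2
  obtain ⟨r, hr0⟩ := B.exists_inv_eq (n := n) (U := ∅) hm (by simpa using hr 0)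
  obtain ⟨st, s, hst, hc⟩ := exists_isFlipChain hm l r h.nodup (by simp [hr0])
    (by simpa [hr0] using hr)
  have hs := (hc.spec hm).2.2.1
  let γ : FlipPath n m ∅ J := ⟨r, st, s, hc, hr0, by
    rw [hs, hr0, hst, Finset.empty_union]
    ext A
    rw [List.mem_toFinset, h.mem]⟩
  have hγ : γ.word = l := hst
  exact ⟨γ, hγ, (hγ ▸ h : Good (m + 1) J U γ.word).path_inv_eq h1 h2⟩

/-! ### Path classes and their inversion sets -/

theorem FlipPath.setS_subset_inv (γ : FlipPath n m ∅ J) : setS n (m + 1) J ⊆ γ.inv :=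
  Finset.subset_union_right

theorem FlipPath.inv_subset (γ : FlipPath n m ∅ J) :
    γ.inv ⊆ setS n (m + 1) J ∪ setF n (m + 1) J :=
  Finset.union_subset ((Finset.filter_subset _ _).trans Finset.subset_union_right)
    Finset.subset_union_left

theorem PathClass.inv_mem (hm : 0 < m) (hJ : Realizable n (m + 1) J) (r : PathClass n m J) :
    r.inv ∈ realizableBetween n (m + 1) J := by
  obtain ⟨γ⟩ := r
  exact ⟨(γ.good hm hJ).realizable hJ γ.setS_subset_inv γ.inv_subset, γ.setS_subset_inv,
    γ.inv_subset⟩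

theorem FlipPath.mk_eq_of_swapSteps (hm : 0 < m) (hJ : Realizable n (m + 1) J)
    (γ : FlipPath n m ∅ J) {l : List (Finset (Fin n))}
    (h : Relation.ReflTransGen (SwapStep (m + 1)) γ.word l) :
    Good (m + 1) J γ.inv l ∧ ∀ γ' : FlipPath n m ∅ J, γ'.word = l →
      (Quot.mk _ γ : PathClass n m J) = Quot.mk _ γ' := by
  induction h with
  | refl => exact ⟨γ.good hm hJ, fun γ' h => by rw [FlipPath.word_injective hm h]⟩
  | tail _ hs ih =>
    refine ⟨ih.1.of_swapStep hs, fun γ' h => ?_⟩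
    -- The intermediate word must come from a genuine path before the quotient relation can be
    -- applied.
    obtain ⟨δ, rfl, -⟩ := ih.1.exists_path hm hJ γ.setS_subset_inv γ.inv_subset
    subst h
    exact (ih.2 δ rfl).trans (Quot.sound hs)

theorem PathClass.inv_injective (hm : 0 < m) (hJ : Realizable n (m + 1) J) :
    Function.Injective (PathClass.inv (n := n) (m := m) (J := J)) := by
  rintro ⟨γ⟩ ⟨γ'⟩ h
  have h' : γ.inv = γ'.inv := h
  exact (γ.mk_eq_of_swapSteps hm hJ
    ((γ.good hm hJ).swapSteps (h' ▸ γ'.good hm hJ))).2 γ' rfl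

theorem PathClass.exists_inv_eq (hm : 0 < m) (hJ : Realizable n (m + 1) J)
    {U : Finset (Finset (Fin n))} (hU : U ∈ realizableBetween n (m + 1) J) :
    ∃ r : PathClass n m J, r.inv = U := by
  obtain ⟨l, hl⟩ := hU.1.exists_good J
  obtain ⟨γ, -, hγ⟩ := hl.exists_path hm hJ hU.2.1 hU.2.2
  exact ⟨Quot.mk _ γ, hγ⟩

/-- Upward flips of path classes are exactly the single step inclusions of inversion sets. -/
theorem PathClass.flipUp_iff (hm : 0 < m) (hJ : Realizable n (m + 1) J) {r r' : PathClass n m J} :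
    PathClass.FlipUp r r' ↔ r.inv ⊂ r'.inv ∧ r'.inv.card = r.inv.card + 1 := by
  constructor
  · rintro ⟨X, hXF, γ, γ', rfl, rfl, hX, u, w, v, h1, h2, hw⟩
    have hXk := (mem_setF.1 hXF).1
    have hg := γ.good hm hJ
    rw [h1] at hg
    have hg' := hg.reverse hXk hX hw
    rw [← h2] at hg'
    have e : γ'.inv = insert X γ.inv := hg'.path_inv_eq
      (γ.setS_subset_inv.trans (Finset.subset_insert _ _))
      (Finset.insert_subset (Finset.mem_union_right _ hXF) γ.inv_subset)
    change γ.inv ⊂ γ'.inv ∧ γ'.inv.card = γ.inv.card + 1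
    rw [e]
    exact ⟨Finset.ssubset_insert hX, Finset.card_insert_of_notMem hX⟩
  · rintro ⟨hss, hcard⟩
    have hr := r.inv_mem hm hJ
    have hr' := r'.inv_mem hm hJ
    obtain ⟨X, hX, e⟩ : ∃ X ∉ r.inv, insert X r.inv = r'.inv := by
      obtain ⟨X, hX'⟩ := Finset.exists_of_ssubset hss
      exact ⟨X, hX'.2, Finset.eq_of_subset_of_card_le
        (Finset.insert_subset hX'.1 hss.subset)
        (by rw [Finset.card_insert_of_notMem hX'.2, hcard])⟩
    have hXr' : X ∈ r'.inv := e ▸ Finset.mem_insert_self _ _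
    -- The new element cannot lie in `J_s`, which every inversion set contains.
    have hXF : X ∈ setF n (m + 1) J :=
      (Finset.mem_union.1 (hr'.2.2 hXr')).resolve_left fun h => hX (hr.2.1 h)
    obtain ⟨u, w, v, hg, hw⟩ := hr.1.exists_good_block (e ▸ hr'.1) hXF hX
    have hg' := hg.reverse (mem_setF.1 hXF).1 hX hw
    rw [e] at hg'
    obtain ⟨γ, hγ, hγi⟩ := hg.exists_path hm hJ hr.2.1 hr.2.2
    obtain ⟨γ', hγ', hγi'⟩ := hg'.exists_path hm hJ hr'.2.1 hr'.2.2
    exact ⟨X, hXF, γ, γ', PathClass.inv_injective hm hJ hγi, PathClass.inv_injective hm hJ hγi',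
      hγi ▸ hX, u, w, v, hγ, hγ', hw⟩

/-! ### Comparison of the two orders -/

theorem ssoLE.subset {α : Type*} {𝔘 : Set (Finset α)} {U V : 𝔘} (h : ssoLE 𝔘 U V) :
    U.1 ⊆ V.1 := by
  induction h with
  | refl => exact subset_rfl
  | tail _ h ih => exact ih.trans h.1.subset

theorem isPartialOrder_ssoLE {α : Type*} (𝔘 : Set (Finset α)) : IsPartialOrder 𝔘 (ssoLE 𝔘) where
  refl _ := Relation.ReflTransGen.refl
  trans _ _ _ := Relation.ReflTransGen.trans
  antisymm _ _ h h' := Subtype.ext (h.subset.antisymm h'.subset)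

/-- The bijection between path classes and realizable sets given by the inversion set. -/
noncomputable def PathClass.invEquiv (hm : 0 < m) (hJ : Realizable n (m + 1) J) :
    PathClass n m J ≃ realizableBetween n (m + 1) J :=
  Equiv.ofBijective (fun r => ⟨r.inv, r.inv_mem hm hJ⟩)
    ⟨fun _ _ h => PathClass.inv_injective hm hJ (congrArg Subtype.val h), fun U => by
      obtain ⟨r, hr⟩ := PathClass.exists_inv_eq hm hJ U.2
      exact ⟨r, Subtype.ext hr⟩⟩

theorem PathClass.ssoLE_invEquiv_iff (hm : 0 < m) (hJ : Realizable n (m + 1) J)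
    {r r' : PathClass n m J} : ssoLE (realizableBetween n (m + 1) J)
      (PathClass.invEquiv hm hJ r) (PathClass.invEquiv hm hJ r') ↔ PathClass.msLE r r' := by
  set e := PathClass.invEquiv hm hJ with he
  constructor
  · intro h
    have := Relation.ReflTransGen.lift (p := PathClass.FlipUp) e.symm (fun U V hUV =>
      (PathClass.flipUp_iff hm hJ).2 (by
        have h1 : ∀ W, (e.symm W).inv = W.1 := fun W => congrArg Subtype.val (e.apply_symm_apply W)
        rwa [h1, h1])) _ _ h
    rwa [Function.onFun, e.symm_apply_apply, e.symm_apply_apply] at this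
  · exact fun h => Relation.ReflTransGen.lift e
      (fun _ _ h => (PathClass.flipUp_iff hm hJ).1 h) _ _ h

/-- Antisymmetry is transported from inclusion of inversion sets. -/
theorem PathClass.isPartialOrder_msLE (hm : 0 < m) (hJ : Realizable n (m + 1) J) :
    IsPartialOrder (PathClass n m J) PathClass.msLE where
  refl _ := Relation.ReflTransGen.refl
  trans _ _ _ := Relation.ReflTransGen.trans
  antisymm _ _ h h' := (PathClass.invEquiv hm hJ).injective
    ((isPartialOrder_ssoLE _).antisymm _ _ ((PathClass.ssoLE_invEquiv_iff hm hJ).2 h)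
      ((PathClass.ssoLE_invEquiv_iff hm hJ).2 h'))

end HigherBruhat

theorem mainTheorem3 (n k : ℕ) (hk : 1 < k) (hkn : k ≤ n) (J : Finset (Finset (Fin n)))
    (hJ : HigherBruhat.Realizable n k J) :
    IsPartialOrder (HigherBruhat.PathClass n (k - 1) J) HigherBruhat.PathClass.msLE ∧
    IsPartialOrder (HigherBruhat.realizableBetween n k J)
      (HigherBruhat.ssoLE (HigherBruhat.realizableBetween n k J)) ∧
    ∃ e : RelIso (HigherBruhat.PathClass.msLE (n := n) (m := k - 1) (J := J))
        (HigherBruhat.ssoLE (HigherBruhat.realizableBetween n k J)),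
      ∀ r : HigherBruhat.PathClass n (k - 1) J,
        (e r : Finset (Finset (Fin n))) = r.inv := by
  obtain ⟨m, rfl⟩ : ∃ m, k = m + 1 := ⟨k - 1, by omega⟩
  have hm : 0 < m := by omega
  exact ⟨HigherBruhat.PathClass.isPartialOrder_msLE hm hJ, HigherBruhat.isPartialOrder_ssoLE _,
    ⟨HigherBruhat.PathClass.invEquiv hm hJ,
      HigherBruhat.PathClass.ssoLE_invEquiv_iff hm hJ⟩, fun _ => rfl⟩
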